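/- Let $n\ge 2$ and consider the equation $$\sum_{i,j=1}^n f_{ij}(p)\,u_{x_ix_j}=0,\qquad p=(p^1,\dots,p^n),\quad p^i=u_{x_i},\qquad (*)$$ where $(f_{ij}(p))$ is a smooth real symmetric matrix, non-degenerate at every point of a non-empty open set $\Omega\subset\mathbb R^n$; equations are considered up to a non-zero scalar factor (function of $p$). Regard $\Omega$ as a subset of the affine chart $p\mapsto(1:p^1:\dots:p^n)$ of $P^n$, with conformal structure $f_{ij}\,dp^i\,dp^j$. The equivalence group $SL(n+1,\mathbb R)$ consists of the linear transformations $\tilde{\mathbf x}=C\mathbf x+bu$, $\tilde u=c\,\mathbf x+\beta u$ of determinant one. Lines, cones and quadrics are taken with their complex points. A line through $p\in\Omega$ with direction $v\in\mathbb C^n\setminus\{0\}$ is null at $p$ if $f_{ij}(p)v^iv^j=0$. A line complex is a $(2n-3)$-parameter family of lines: a hypersurface in the variety of lines of $P^n$ given by one homogeneous real equation in Plücker coordinates; it is quadratic if the equation has degree two. It is called a complex of null lines if for every $p\in\Omega$ its lines through $p$ are exactly the lines null at $p$; these lines form the cone of the complex at $p$. The following conditions are equivalent. (1) Equation $(*)$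 is linearizable by a transformation from the equivalence group: some element of $SL(n+1,\mathbb R)$, with $\det(C+bp)\neq0$ for all $p\in\Omega$, carries $(*)$ into a linear equation $\sum a_{ij}\tilde u_{\tilde x_i\tilde x_j}=0$ with constant coefficients. (2) Equation $(*)$ is Lagrangian with a density $Q(p)/l(p)$: it is the Euler–Lagrange equation of $\int \frac{Q(\nabla u)}{l(\nabla u)}\,dx$, where $Q$ is a quadratic and $l$ a linear form in $p^1,\dots,p^n$, not necessarily homogeneous, and $l\ne0$ on $\Omega$. (3) The conformal structure possesses a complex of null lines whose cones at all points of $\Omega$ pass through one and the same non-singular real quadric (possibly without real points) lying in a fixed real hyperplane of $P^n$. If $n=3$, these conditions are also equivalent to (4) the conformal structure possesses a quadratic complex of null lines with Segre symbol $[(222)]$, that is, the pencil spanned by its quadratic form in the six Plücker coordinates and the Plücker form has a single eigenvalue, with three Jordan blocks of size two. Moreover, for $n=3$ and any given quadratic complex of null lines of the conformal structure, (1)–(3) hold if and only if that complex has Segre symbol $[(222)]$. -/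

import Mathlib

open scoped Matrix ContDiff Topology

noncomputable section

/-- The row of first order derivatives `(∂u/∂x₁, …, ∂u/∂xₙ)` at `x`. -/
def grad {n : ℕ} (u : (Fin n → ℝ) → ℝ) (x : Fin n → ℝ) : Fin n → ℝ :=
  fun i => fderiv ℝ u x (Pi.single i 1)

/-- The Hessian matrix `(∂²u/∂xᵢ∂xⱼ)` at `x`. -/
def hess {n : ℕ} (u : (Fin n → ℝ) → ℝ) (x : Fin n → ℝ) : Matrix (Fin n) (Fin n) ℝ :=
  Matrix.of fun i j => grad (fun y => grad u y j) x i

/-- A second order quasilinear equation `∑ fᵢⱼ(p) u_{xᵢxⱼ} = 0`, `pⁱ = u_{xᵢ}`, whose coefficient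
matrix is smooth, symmetric and non-degenerate on a non-empty open set of values of `p`. The same
data is the conformal structure `fᵢⱼ dpⁱ dpʲ` on this open subset of the affine chart of
projective space. -/
structure QuasilinearEquation (n : ℕ) where
  domain : Set (Fin n → ℝ)
  isOpen_domain : IsOpen domain
  nonempty_domain : domain.Nonempty
  coeff : (Fin n → ℝ) → Matrix (Fin n) (Fin n) ℝ
  smooth_coeff : ∀ i j, ContDiffOn ℝ ∞ (fun p => coeff p i j) domain
  symm_coeff : ∀ p ∈ domain, (coeff p).IsSymm
  nondegenerate_coeff : ∀ p ∈ domain, (coeff p).det ≠ 0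

/-- `u` satisfies `∑ mᵢⱼ u_{xᵢxⱼ} = 0` at the point `x`, for a given value `M = (mᵢⱼ)` of the
coefficient matrix at that point. -/
def SatisfiesAt {n : ℕ} (M : Matrix (Fin n) (Fin n) ℝ) (u : (Fin n → ℝ) → ℝ)
    (x : Fin n → ℝ) : Prop :=
  ∑ i, ∑ j, M i j * hess u x i j = 0

/-- `u` satisfies the quasilinear equation at the point `x`. -/
def QuasilinearEquation.HoldsAt {n : ℕ} (E : QuasilinearEquation n) (u : (Fin n → ℝ) → ℝ)
    (x : Fin n → ℝ) : Prop :=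
  SatisfiesAt (E.coeff (grad u x)) u x

/-! ### The equivalence group -/

/-- The group of linear transformations of `(x₁, …, xₙ, u)` of determinant one. -/
abbrev EquivalenceGroup (n : ℕ) := Matrix.SpecialLinearGroup (Fin n ⊕ Unit) ℝ

namespace EquivalenceGroup

/-- The image of the point `(x, u(x))` of the graph of `u` under the linear map `T`. -/
def image {n : ℕ} (T : EquivalenceGroup n) (u : (Fin n → ℝ) → ℝ) (x : Fin n → ℝ) :
    Fin n ⊕ Unit → ℝ :=
  (T : Matrix (Fin n ⊕ Unit) (Fin n ⊕ Unit) ℝ) *ᵥ Sum.elim x (fun _ => u x)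

/-- The new independent variables `C x + b u`. -/
def newX {n : ℕ} (T : EquivalenceGroup n) (u : (Fin n → ℝ) → ℝ) (x : Fin n → ℝ) : Fin n → ℝ :=
  fun i => T.image u x (Sum.inl i)

/-- The new dependent variable `c x + β u`. -/
def newU {n : ℕ} (T : EquivalenceGroup n) (u : (Fin n → ℝ) → ℝ) (x : Fin n → ℝ) : ℝ :=
  T.image u x (Sum.inr ())

/-- The Jacobian matrix `C + b p` of `x ↦ C x + b u(x)` at a point where the derivatives of `u`
are `p`. Where it is invertible, the image of the graph of `u` is locally a graph again. -/
def jacobian {n : ℕ} (T : EquivalenceGroup n) (p : Fin n → ℝ) : Matrix (Fin n) (Fin n) ℝ :=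
  Matrix.of fun i j => (T : Matrix (Fin n ⊕ Unit) (Fin n ⊕ Unit) ℝ) (Sum.inl i) (Sum.inl j) +
    (T : Matrix (Fin n ⊕ Unit) (Fin n ⊕ Unit) ℝ) (Sum.inl i) (Sum.inr ()) * p j

/-- Near `x`, `T` maps the graph of `u` into the graph of `u'`. -/
def MapsGraph {n : ℕ} (T : EquivalenceGroup n) (u u' : (Fin n → ℝ) → ℝ) (x : Fin n → ℝ) : Prop :=
  ∀ᶠ y in 𝓝 x, u' (T.newX u y) = T.newU u y

end EquivalenceGroup

/-- The equation is linearizable by a transformation from the equivalence group: some `T` is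
regular on the whole domain, and the transformed equation is a linear equation
`∑ aᵢⱼ ũ_{x̃ᵢx̃ⱼ} = 0` with constant coefficients. -/
def QuasilinearEquation.Linearizable {n : ℕ} (E : QuasilinearEquation n) : Prop :=
  ∃ (T : EquivalenceGroup n) (A : Matrix (Fin n) (Fin n) ℝ), A.IsSymm ∧ A.det ≠ 0 ∧
    (∀ p ∈ E.domain, (T.jacobian p).det ≠ 0) ∧
    ∀ (u u' : (Fin n → ℝ) → ℝ) (x : Fin n → ℝ),
      ContDiffAt ℝ 2 u x → ContDiffAt ℝ 2 u' (T.newX u x) →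
      grad u x ∈ E.domain → T.MapsGraph u u' x →
      (E.HoldsAt u x ↔ SatisfiesAt A u' (T.newX u x))

/-! ### Lagrangian equations -/

/-- The Euler–Lagrange expression `∑ ∂/∂xᵢ (∂g/∂pⁱ)(∇u)` of the functional `∫ g(∇u) dx`. -/
def eulerLagrange {n : ℕ} (g u : (Fin n → ℝ) → ℝ) (x : Fin n → ℝ) : ℝ :=
  ∑ i, grad (fun y => grad g (grad u y) i) x i

/-- The equation is the Euler–Lagrange equation of the functional `∫ g(∇u) dx`. -/
def QuasilinearEquation.IsLagrangianWithDensity {n : ℕ} (E : QuasilinearEquation n)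
    (g : (Fin n → ℝ) → ℝ) : Prop :=
  ContDiffOn ℝ ∞ g E.domain ∧
    ∀ (u : (Fin n → ℝ) → ℝ) (x : Fin n → ℝ), ContDiffAt ℝ 2 u x → grad u x ∈ E.domain →
      (E.HoldsAt u x ↔ eulerLagrange g u x = 0)

/-- The not necessarily homogeneous linear form `l₀ + l₁ p¹ + … + lₙ pⁿ`. -/
def affineForm {n : ℕ} (l : Fin (n + 1) → ℝ) (p : Fin n → ℝ) : ℝ :=
  l ⬝ᵥ (Fin.cons 1 p : Fin (n + 1) → ℝ)

/-- The not necessarily homogeneous quadratic form in `p` with symmetric coefficient matrix `Q`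
with respect to `(1, p¹, …, pⁿ)`. -/
def affineQuadraticForm {n : ℕ} (Q : Matrix (Fin (n + 1)) (Fin (n + 1)) ℝ) (p : Fin n → ℝ) : ℝ :=
  (Fin.cons 1 p : Fin (n + 1) → ℝ) ⬝ᵥ Q *ᵥ (Fin.cons 1 p : Fin (n + 1) → ℝ)

/-- The equation is Lagrangian with a density of the form `Q(p)/l(p)`, where `l` does not vanish
on the domain. -/
def QuasilinearEquation.IsLagrangianQuadraticOverLinear {n : ℕ}
    (E : QuasilinearEquation n) : Prop :=
  ∃ (Q : Matrix (Fin (n + 1)) (Fin (n + 1)) ℝ) (l : Fin (n + 1) → ℝ), Q.IsSymm ∧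
    (∀ p ∈ E.domain, affineForm l p ≠ 0) ∧
    E.IsLagrangianWithDensity (fun p => affineQuadraticForm Q p / affineForm l p)

/-! ### Complexes of null lines in complex projective space -/

/-- A line of the complex projective space `Pⁿ`: a two-dimensional subspace of `ℂⁿ⁺¹`. -/
def IsProjLine {n : ℕ} (L : Submodule ℂ (Fin (n + 1) → ℂ)) : Prop :=
  Module.finrank ℂ L = 2

/-- Homogeneous coordinates `(1 : p¹ : … : pⁿ)` of the point `p` of the affine chart. -/
def homog {n : ℕ} (p : Fin n → ℝ) : Fin (n + 1) → ℂ :=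
  Fin.cons 1 (fun i => (p i : ℂ))

/-- Plücker coordinates `aᵢbⱼ - aⱼbᵢ` of the line through the points `a` and `b`. -/
def plucker {n : ℕ} (a b : Fin (n + 1) → ℂ) : Fin (n + 1) × Fin (n + 1) → ℂ :=
  fun s => a s.1 * b s.2 - a s.2 * b s.1

/-- A line complex, that is, a `(2n-3)`-parameter family of lines: the hypersurface in the
`(2n-2)`-dimensional variety of lines of `Pⁿ` cut out by a single homogeneous equation of positive
degree (with real coefficients) in the Plücker coordinates that does not hold for all lines. -/
def IsLineComplex {n : ℕ} (K : Set (Submodule ℂ (Fin (n + 1) → ℂ))) : Prop :=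
  ∃ (d : ℕ) (Φ : MvPolynomial (Fin (n + 1) × Fin (n + 1)) ℝ), 0 < d ∧ Φ.IsHomogeneous d ∧
    (K = {L | IsProjLine L ∧ ∀ a ∈ L, ∀ b ∈ L, MvPolynomial.aeval (plucker a b) Φ = 0}) ∧
    ∃ L, IsProjLine L ∧ L ∉ K

/-- The line `L`, passing through the point `p`, is null at `p`: its direction `v` satisfies
`∑ fᵢⱼ(p) vⁱ vʲ = 0`. -/
def QuasilinearEquation.IsNullAt {n : ℕ} (E : QuasilinearEquation n)
    (L : Submodule ℂ (Fin (n + 1) → ℂ)) (p : Fin n → ℝ) : Prop :=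
  ∀ v : Fin n → ℂ, (Fin.cons 0 v : Fin (n + 1) → ℂ) ∈ L →
    ∑ i, ∑ j, (E.coeff p i j : ℂ) * v i * v j = 0

/-- The family `K` consists of null lines, and its lines through each point `p` of the domain fill
the null cone of the conformal structure at `p`. -/
def QuasilinearEquation.IsFamilyOfNullLines {n : ℕ} (E : QuasilinearEquation n)
    (K : Set (Submodule ℂ (Fin (n + 1) → ℂ))) : Prop :=
  ∀ p ∈ E.domain, ∀ L : Submodule ℂ (Fin (n + 1) → ℂ), IsProjLine L → homog p ∈ L →
    (L ∈ K ↔ E.IsNullAt L p)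

/-- The cone with vertex `p` formed by the lines of the family `K` that pass through `p` (as a
set of vectors of homogeneous coordinates). -/
def coneAt {n : ℕ} (K : Set (Submodule ℂ (Fin (n + 1) → ℂ))) (p : Fin n → ℝ) :
    Set (Fin (n + 1) → ℂ) :=
  {w | ∃ L ∈ K, homog p ∈ L ∧ w ∈ L}

/-- The (complex) points, in homogeneous coordinates, of the quadric `wᵀ S w = 0` in the
hyperplane `h · w = 0`. -/
def hyperplaneQuadric {n : ℕ} (h : Fin (n + 1) → ℝ)
    (S : Matrix (Fin (n + 1)) (Fin (n + 1)) ℝ) : Set (Fin (n + 1) → ℂ) :=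
  {w | w ≠ 0 ∧ ∑ i, (h i : ℂ) * w i = 0 ∧ ∑ i, ∑ j, (S i j : ℂ) * w i * w j = 0}

/-- The quadratic form of `S` is non-degenerate on the hyperplane `h · w = 0`. -/
def NonsingularOn {n : ℕ} (h : Fin (n + 1) → ℝ)
    (S : Matrix (Fin (n + 1)) (Fin (n + 1)) ℝ) : Prop :=
  ∀ w : Fin (n + 1) → ℝ, h ⬝ᵥ w = 0 →
    (∀ w' : Fin (n + 1) → ℝ, h ⬝ᵥ w' = 0 → w ⬝ᵥ S *ᵥ w' = 0) → w = 0

/-- The conformal structure possesses a complex of null lines all of whose cones pass through one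
and the same quadric lying in a fixed hyperplane. -/
def QuasilinearEquation.HasNullComplexThroughHyperplaneQuadric {n : ℕ}
    (E : QuasilinearEquation n) : Prop :=
  ∃ K : Set (Submodule ℂ (Fin (n + 1) → ℂ)), IsLineComplex K ∧ E.IsFamilyOfNullLines K ∧
    ∃ (h : Fin (n + 1) → ℝ) (S : Matrix (Fin (n + 1)) (Fin (n + 1)) ℝ),
      h ≠ 0 ∧ S.IsSymm ∧ NonsingularOn h S ∧
      ∀ p ∈ E.domain, hyperplaneQuadric h S ⊆ coneAt K p

/-! ### Quadratic line complexes in `P³` -/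

/-- The six Plücker coordinates `(p₀₁, p₀₂, p₀₃; p₂₃, p₃₁, p₁₂)` of a line in `P³`. -/
def plucker6 (a b : Fin 4 → ℂ) : Fin 3 ⊕ Fin 3 → ℂ :=
  Sum.elim ![plucker a b (0, 1), plucker a b (0, 2), plucker a b (0, 3)]
    ![plucker a b (2, 3), plucker a b (3, 1), plucker a b (1, 2)]

/-- The matrix of (twice) the Plücker quadratic form `p₀₁p₂₃ + p₀₂p₃₁ + p₀₃p₁₂`, whose zero set
consists of the lines. -/
def pluckerMatrix : Matrix (Fin 3 ⊕ Fin 3) (Fin 3 ⊕ Fin 3) ℂ :=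
  Matrix.fromBlocks 0 1 1 0

/-- The set of lines of `P³` whose Plücker coordinates satisfy the quadratic relation with
coefficient matrix `M`. -/
def quadraticComplex (M : Matrix (Fin 3 ⊕ Fin 3) (Fin 3 ⊕ Fin 3) ℝ) :
    Set (Submodule ℂ (Fin 4 → ℂ)) :=
  {L | IsProjLine L ∧ ∀ a ∈ L, ∀ b ∈ L,
    plucker6 a b ⬝ᵥ (M.map (fun r : ℝ => (r : ℂ))) *ᵥ plucker6 a b = 0}

/-- The Segre symbol of the quadratic complex with matrix `M` is `[(222)]`: the pencil
`M - t • pluckerMatrix` has a single eigenvalue `μ`, and to it belong three Jordan blocks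
(elementary divisors `(t - μ)²`) of size two. -/
def HasSegreSymbol222 (M : Matrix (Fin 3 ⊕ Fin 3) (Fin 3 ⊕ Fin 3) ℝ) : Prop :=
  ∃ (μ : ℂ) (G : Matrix (Fin 3 ⊕ Fin 3) (Fin 2 × Fin 3) ℂ)
    (G' : Matrix (Fin 2 × Fin 3) (Fin 3 ⊕ Fin 3) ℂ), G * G' = 1 ∧ G' * G = 1 ∧
    pluckerMatrix⁻¹ * M.map (fun r : ℝ => (r : ℂ)) =
      G * Matrix.blockDiagonal (fun _ : Fin 3 => !![μ, 1; 0, μ]) * G'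

end

/-! All conditions are compared with one normal form, `HasProjectiveNormalForm`: up to a scalar,
f(p) = Rᵀ f(p₀) R, where r = p - p₀ and R v = (1 + a·r) v - (a·v) r. The vector R v is the direction
from p₀ to the point (possibly at infinity) where the line through p with direction v meets the
hyperplane 1 + a·(p - p₀) = 0. So the null cone at every p is the cone over one quadric in a fixed
hyperplane. Equivalently (`hasProjectiveNormalForm_iff`), f(p) is a multiple of the pullback of a
fixed form S by v ↦ l(p)(0, v) - l(v)(1, p).

Statements about solutions become statements about matrices by testing on quadratic polynomials,
which realise every gradient and symmetric Hessian; matrices with the same annihilator are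
proportional (`exists_eq_smul_of_annihilator`).

Linearization: Hessians transform by JᵀH̃J = sH with J(p) = C + b pᵀ, so constant coefficients A
pull back to J⁻¹AJ⁻ᵀ. Since J(p) = J(p₀)(1 + a rᵀ) and (1 + a rᵀ)⁻¹ = Rᵀ/(1 + a·r), this is the
normal form. Lagrangians: the Hessian of Q/l is 2/l³ times the pullback of Q by the map above, so Q
plays the role of S. Quadrics: the lines meeting a quadric in a hyperplane form a quadratic complex.
Conversely, the complex null vectors of a non-degenerate real form determine it up to a factor
(`exists_eq_smul_of_null`); the delicate point is that the domain avoids the hyperplane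
(`affineForm_ne_zero_of_quadric`).

For n = 3 the line through p with direction v has Plücker coordinates (v, p × v), and R v = v - a ×
(r × v) is linear in the coordinates (v, r × v) taken with origin p₀. Hence the normal form is the
cone of the matrix (1 | Z)ᵀ B (1 | Z) with Z skew, and the complex determines its matrix up to a
factor and a multiple μ of the Plücker matrix Ω. Skewness of Z means (ΩM - μ)² = 0, and the rank
three of this nilpotent gives three Jordan blocks of size two. -/

/-! ### Symmetric forms with the same null vectors -/

/-- A symmetric bilinear form on a real vector space that vanishes on all complex null vectors
`a + ib` of a non-degenerate symmetric form `F` is a multiple of `F`. -/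
theorem LinearMap.BilinForm.exists_eq_smul_of_null {V : Type*} [AddCommGroup V] [Module ℝ V]
    [FiniteDimensional ℝ V] (F G : LinearMap.BilinForm ℝ V) (hF : ∀ x y, F x y = F y x)
    (hG : ∀ x y, G x y = G y x) (hnd : ∀ x, (∀ y, F x y = 0) → x = 0)
    (h : ∀ a b, F a a = F b b → F a b = 0 → G a a = G b b ∧ G a b = 0) :
    ∃ c : ℝ, ∀ x y, G x y = c * F x y := by
  -- In an F-orthogonal basis, squares of opposite sign give the real null vectors s vᵢ ± vⱼ, and
  -- squares of equal sign give the complex null vector s vᵢ + i vⱼ. Either way G is diagonal on the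
  -- pair, with entries proportional to those of F.
  obtain ⟨v, hv⟩ := LinearMap.BilinForm.exists_orthogonal_basis (B := F) ⟨hF⟩
  have ho : ∀ i j, i ≠ j → F (v i) (v j) = 0 := fun i j hij => hv hij
  have hd : ∀ i, F (v i) (v i) ≠ 0 := by
    intro i hi
    refine v.ne_zero i (hnd _ fun y => ?_)
    have : F (v i) = 0 := v.ext fun j => by
      by_cases hij : i = j
      · subst hij; simpa using hi
      · simpa using ho i j hij
    simp [this]
  have hgo : ∀ i j, i ≠ j → G (v i) (v j) = 0 ∧
      F (v j) (v j) * G (v i) (v i) = F (v i) (v i) * G (v j) (v j) := by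
    intro i j hij
    have hji := ho j i hij.symm
    have hij' := ho i j hij
    have hGs := hG (v j) (v i)
    rcases lt_or_gt_of_ne (div_ne_zero (hd j) (hd i)) with hneg | hpos
    · obtain ⟨s, hs⟩ : ∃ s : ℝ, s * s = -(F (v j) (v j) / F (v i) (v i)) :=
        ⟨√(-(F (v j) (v j) / F (v i) (v i))), Real.mul_self_sqrt (by linarith)⟩
      have hs' : s * s * F (v i) (v i) = -F (v j) (v j) := by
        rw [hs]; field_simp [hd i]
      have h1 := (h (s • v i + v j) 0 (by simp [hji, hij']; linarith) (by simp)).1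
      have h2 := (h (s • v i - v j) 0 (by simp [hji, hij']; linarith) (by simp)).1
      simp only [map_add, map_sub, map_smul, LinearMap.add_apply, LinearMap.sub_apply,
        LinearMap.smul_apply, smul_eq_mul, map_zero, hGs] at h1 h2
      have hs0 : s ≠ 0 := by
        rintro rfl
        apply hd j; linarith
      refine ⟨?_, ?_⟩
      · have : s * G (v i) (v j) = 0 := by linarith
        simpa [hs0] using this
      · have : s * s * G (v i) (v i) = -G (v j) (v j) := by linarith
        have h3 : s * s ≠ 0 := mul_ne_zero hs0 hs0
        apply mul_left_cancel₀ h3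
        linear_combination F (v j) (v j) * this - G (v j) (v j) * hs'
    · obtain ⟨s, hs⟩ : ∃ s : ℝ, s * s = F (v j) (v j) / F (v i) (v i) :=
        ⟨√(F (v j) (v j) / F (v i) (v i)), Real.mul_self_sqrt hpos.le⟩
      have hs' : s * s * F (v i) (v i) = F (v j) (v j) := by
        rw [hs]; field_simp [hd i]
      have h1 := h (s • v i) (v j) (by simp; linarith) (by simp [hij'])
      simp only [map_smul, LinearMap.smul_apply, smul_eq_mul] at h1
      have hs0 : s ≠ 0 := by
        rintro rfl
        apply hd j; linarith
      refine ⟨by simpa [hs0] using h1.2, ?_⟩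
      have h3 : s * s ≠ 0 := mul_ne_zero hs0 hs0
      apply mul_left_cancel₀ h3
      linear_combination F (v j) (v j) * h1.1 - G (v j) (v j) * hs'
  rcases isEmpty_or_nonempty (Fin (Module.finrank ℝ V)) with he | ⟨⟨i₀⟩⟩
  · refine ⟨0, fun x y => ?_⟩
    have : G = 0 := v.ext fun i => he.elim i
    simp [this]
  · refine ⟨G (v i₀) (v i₀) / F (v i₀) (v i₀), fun x y => ?_⟩
    have : G = (G (v i₀) (v i₀) / F (v i₀) (v i₀)) • F := by
      refine LinearMap.BilinForm.ext_basis v fun i j => ?_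
      simp only [LinearMap.smul_apply, smul_eq_mul]
      by_cases hij : i = j
      · subst hij
        by_cases hi : i = i₀
        · subst hi; field_simp [hd i]
        · have := (hgo i i₀ hi).2
          have h0 := hd i₀
          field_simp
          linarith
      · rw [(hgo i j hij).1, ho i j hij, mul_zero]
    conv_lhs => rw [this]
    simp

/-- The value of a real matrix, viewed as a quadratic form, at a complex vector. -/
noncomputable def complexQuad {m : Type*} [Fintype m] (A : Matrix m m ℝ) (v : m → ℂ) : ℂ :=
  ∑ i, ∑ j, (A i j : ℂ) * v i * v j

/-! ### Real quadratic forms at complex vectors -/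

theorem dotProduct_mulVec_comm {m : Type*} [Fintype m] {A : Matrix m m ℝ} (hA : A.IsSymm)
    (x y : m → ℝ) : x ⬝ᵥ A *ᵥ y = y ⬝ᵥ A *ᵥ x := by
  rw [dotProduct_comm, ← Matrix.vecMul_transpose, hA.eq, ← Matrix.dotProduct_mulVec]

theorem dotProduct_mulVec_eq_sum {m R : Type*} [Fintype m] [CommSemiring R] (A : Matrix m m R)
    (x y : m → R) : x ⬝ᵥ A *ᵥ y = ∑ i, ∑ j, A i j * x i * y j := by
  simp only [dotProduct, Matrix.mulVec, Finset.mul_sum]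
  exact Finset.sum_congr rfl fun i _ => Finset.sum_congr rfl fun j _ => by ring

theorem complexQuad_add_I_mul {m : Type*} [Fintype m] {A : Matrix m m ℝ} (hA : A.IsSymm)
    (a b : m → ℝ) : complexQuad A (fun i => a i + Complex.I * b i) =
      ((a ⬝ᵥ A *ᵥ a - b ⬝ᵥ A *ᵥ b : ℝ) : ℂ) + Complex.I * ((2 * (a ⬝ᵥ A *ᵥ b) : ℝ) : ℂ) := by
  have h2 : (2 * (a ⬝ᵥ A *ᵥ b) : ℝ) = a ⬝ᵥ A *ᵥ b + b ⬝ᵥ A *ᵥ a := by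
    rw [dotProduct_mulVec_comm hA b a]; ring
  rw [h2]
  simp only [dotProduct_mulVec_eq_sum, complexQuad]
  push_cast
  simp only [Finset.mul_sum, ← Finset.sum_add_distrib, ← Finset.sum_sub_distrib]
  refine Finset.sum_congr rfl fun i _ => Finset.sum_congr rfl fun j _ => ?_
  linear_combination (A i j * b i * b j : ℂ) * Complex.I_mul_I

theorem complexQuad_add_I_mul_eq_zero {m : Type*} [Fintype m] {A : Matrix m m ℝ} (hA : A.IsSymm)
    (a b : m → ℝ) : complexQuad A (fun i => a i + Complex.I * b i) = 0 ↔
      a ⬝ᵥ A *ᵥ a = b ⬝ᵥ A *ᵥ b ∧ a ⬝ᵥ A *ᵥ b = 0 := by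
  rw [complexQuad_add_I_mul hA, Complex.ext_iff]
  simp [sub_eq_zero, -Complex.ofReal_sub, -Complex.ofReal_mul]

theorem complexQuad_ofReal {m : Type*} [Fintype m] (A : Matrix m m ℝ) (a : m → ℝ) :
    complexQuad A (fun i => (a i : ℂ)) = ((a ⬝ᵥ A *ᵥ a : ℝ) : ℂ) := by
  simp only [dotProduct_mulVec_eq_sum, complexQuad]
  push_cast
  rfl

theorem complexQuad_smul {m : Type*} [Fintype m] (A : Matrix m m ℝ) (c : ℂ) (v : m → ℂ) :
    complexQuad A (c • v) = c ^ 2 * complexQuad A v := by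
  simp only [complexQuad, Finset.mul_sum, Pi.smul_apply, smul_eq_mul]
  exact Finset.sum_congr rfl fun i _ => Finset.sum_congr rfl fun j _ => by ring

theorem complexQuad_smul_matrix {m : Type*} [Fintype m] (A : Matrix m m ℝ) (c : ℝ) (v : m → ℂ) :
    complexQuad (c • A) v = c * complexQuad A v := by
  simp only [complexQuad, Finset.mul_sum, Matrix.smul_apply, smul_eq_mul]
  exact Finset.sum_congr rfl fun i _ => Finset.sum_congr rfl fun j _ => by push_cast; ring

theorem Matrix.IsSymm.ext_quad {m : Type*} [Fintype m] [DecidableEq m] {A B : Matrix m m ℝ}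
    (hA : A.IsSymm) (hB : B.IsSymm) (h : ∀ x, x ⬝ᵥ A *ᵥ x = x ⬝ᵥ B *ᵥ x) : A = B := by
  ext i j
  have h1 := h (Pi.single i 1 + Pi.single j 1)
  have h2 := h (Pi.single i 1)
  have h3 := h (Pi.single j 1)
  have h4 := dotProduct_mulVec_comm hA (Pi.single i 1) (Pi.single j 1)
  have h5 := dotProduct_mulVec_comm hB (Pi.single i 1) (Pi.single j 1)
  simp only [Matrix.mulVec_add, dotProduct_add, add_dotProduct] at h1
  have h6 : Pi.single i 1 ⬝ᵥ A *ᵥ Pi.single j 1 = A i j := by simp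
  have h7 : Pi.single i 1 ⬝ᵥ B *ᵥ Pi.single j 1 = B i j := by simp
  linarith

theorem Matrix.eq_zero_of_dotProduct_mulVec {m : Type*} [Fintype m] [DecidableEq m]
    {A : Matrix m m ℝ} (hA : A.IsSymm) (hdet : A.det ≠ 0) {x : m → ℝ}
    (h : ∀ y, x ⬝ᵥ A *ᵥ y = 0) : x = 0 := by
  apply Matrix.eq_zero_of_mulVec_eq_zero hdet
  ext i
  have := h (Pi.single i 1)
  rw [dotProduct_mulVec_comm hA] at this
  simpa using this

/-- Complex vectors are needed because a definite form has no nonzero real null vector. The real and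
imaginary parts of the value at a + ib are the two conditions of `exists_eq_smul_of_null`. -/
theorem exists_eq_smul_of_complexQuad {m : Type*} [Fintype m] [DecidableEq m] {A B : Matrix m m ℝ}
    (hA : A.IsSymm) (hB : B.IsSymm) (hdet : A.det ≠ 0)
    (h : ∀ v, complexQuad A v = 0 → complexQuad B v = 0) : ∃ c : ℝ, B = c • A := by
  obtain ⟨c, hc⟩ := LinearMap.BilinForm.exists_eq_smul_of_null (Matrix.toBilin' A)
    (Matrix.toBilin' B) (fun x y => by simp only [Matrix.toBilin'_apply']
                                       exact dotProduct_mulVec_comm hA x y)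
    (fun x y => by simp only [Matrix.toBilin'_apply']; exact dotProduct_mulVec_comm hB x y)
    (fun x hx => Matrix.eq_zero_of_dotProduct_mulVec hA hdet fun y => by
      simpa only [Matrix.toBilin'_apply'] using hx y)
    (fun a b hab hab' => by
      simp only [Matrix.toBilin'_apply'] at *
      exact (complexQuad_add_I_mul_eq_zero hB a b).1
        (h _ ((complexQuad_add_I_mul_eq_zero hA a b).2 ⟨hab, hab'⟩)))
  refine ⟨c, Matrix.IsSymm.ext_quad hB (hA.smul c) fun x => ?_⟩
  have := hc x x
  simp only [Matrix.toBilin'_apply'] at this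
  rw [this, Matrix.smul_mulVec, dotProduct_smul, smul_eq_mul]

/-- Symmetric matrices whose annihilators, with respect to the trace form, coincide in the space
of symmetric matrices are proportional. -/
theorem exists_eq_smul_of_annihilator {m : Type*} [Fintype m] {A B : Matrix m m ℝ}
    (hA : A.IsSymm) (hB : B.IsSymm) (hB0 : B ≠ 0)
    (h : ∀ H : Matrix m m ℝ, H.IsSymm →
      (∑ i, ∑ j, A i j * H i j = 0 ↔ ∑ i, ∑ j, B i j * H i j = 0)) :
    ∃ c : ℝ, c ≠ 0 ∧ A = c • B := by
  set s : Matrix m m ℝ → Matrix m m ℝ → ℝ := fun X Y => ∑ i, ∑ j, X i j * Y i j with hs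
  have hlin : ∀ (X Y Z : Matrix m m ℝ) (c d : ℝ), s X (c • Y - d • Z) = c * s X Y - d * s X Z := by
    intro X Y Z c d
    simp only [hs, Finset.mul_sum, ← Finset.sum_sub_distrib, Matrix.sub_apply, Matrix.smul_apply,
      smul_eq_mul]
    exact Finset.sum_congr rfl fun i _ => Finset.sum_congr rfl fun j _ => by ring
  have hcomm : ∀ X Y, s X Y = s Y X := fun X Y =>
    Finset.sum_congr rfl fun i _ => Finset.sum_congr rfl fun j _ => mul_comm _ _
  have hpos : ∀ X, s X X = 0 → X = 0 := by
    intro X hX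
    ext i j
    have h1 := (Finset.sum_eq_zero_iff_of_nonneg fun i _ =>
      Finset.sum_nonneg fun j _ => mul_self_nonneg (X i j)).1 hX i (Finset.mem_univ _)
    have h2 := (Finset.sum_eq_zero_iff_of_nonneg fun j _ => mul_self_nonneg (X i j)).1 h1 j
      (Finset.mem_univ _)
    simpa using h2
  have hBB : s B B ≠ 0 := fun h0 => hB0 (hpos B h0)
  -- H is a multiple of the component of A orthogonal to B. It annihilates B, hence A, hence itself,
  -- so it vanishes because the trace form is positive definite.
  set H := s B B • A - s B A • B with hH
  have hHs : H.IsSymm := (hA.smul _).sub (hB.smul _)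
  have h1 : s B H = 0 := by rw [hH, hlin]; ring
  have h2 : s A H = 0 := (h H hHs).2 h1
  have h3 : s H H = 0 := by
    conv_lhs => rw [hH]
    rw [← hH, hcomm, hlin, hcomm H A, hcomm H B, h1, h2]; ring
  have h4 := hpos H h3
  have h5 : A = (s B A / s B B) • B := by
    rw [hH, sub_eq_zero] at h4
    rw [div_eq_inv_mul, mul_smul, ← h4, smul_smul, inv_mul_cancel₀ hBB, one_smul]
  refine ⟨_, ?_, h5⟩
  intro h0
  rw [h0, zero_smul] at h5
  apply hBB
  refine (h B hB).1 ?_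
  simp [h5]

/-! ### The projective normal form of the conformal structure -/

/-- The matrix of `v ↦ (1 + a · r) v - (a · v) r`. -/
def slideMatrix {n : ℕ} (a r : Fin n → ℝ) : Matrix (Fin n) (Fin n) ℝ :=
  (1 + a ⬝ᵥ r) • 1 - Matrix.vecMulVec r a

/-- The conformal structure is obtained from its value at one point `p₀` by projecting directions
to a fixed hyperplane, `1 + a · (p - p₀) = 0`, that does not meet the domain. -/
def QuasilinearEquation.HasProjectiveNormalForm {n : ℕ} (E : QuasilinearEquation n) : Prop :=
  ∃ p₀ ∈ E.domain, ∃ a : Fin n → ℝ, ∀ p ∈ E.domain, 1 + a ⬝ᵥ (p - p₀) ≠ 0 ∧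
    ∃ c : ℝ, c ≠ 0 ∧
      E.coeff p = c • ((slideMatrix a (p - p₀))ᵀ * E.coeff p₀ * slideMatrix a (p - p₀))

/-- The matrix of the map that sends a direction `v` at `p` to the point `l(p) (0, v) - l(v) (1, p)`
in which the line through `p` with direction `v` meets the hyperplane `l = 0`. -/
def meetMatrix {n : ℕ} (l : Fin (n + 1) → ℝ) (p : Fin n → ℝ) : Matrix (Fin (n + 1)) (Fin n) ℝ :=
  Matrix.of fun s j => affineForm l p * (Fin.cons 0 (Pi.single j 1) : Fin (n + 1) → ℝ) s -
    l j.succ * (Fin.cons 1 p : Fin (n + 1) → ℝ) s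

theorem slideMatrix_mulVec {n : ℕ} (a r v : Fin n → ℝ) :
    slideMatrix a r *ᵥ v = (1 + a ⬝ᵥ r) • v - (a ⬝ᵥ v) • r := by
  rw [slideMatrix, Matrix.sub_mulVec, Matrix.smul_mulVec, Matrix.one_mulVec,
    Matrix.vecMulVec_mulVec, op_smul_eq_smul]

theorem affineForm_eq {n : ℕ} (l : Fin (n + 1) → ℝ) (p : Fin n → ℝ) :
    affineForm l p = l 0 + (fun i => l (Fin.succ i)) ⬝ᵥ p := by
  simp [affineForm, dotProduct, Fin.sum_univ_succ]

theorem meetMatrix_mulVec {n : ℕ} (l : Fin (n + 1) → ℝ) (p v : Fin n → ℝ) :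
    meetMatrix l p *ᵥ v = (Fin.cons (-((fun i => l (Fin.succ i)) ⬝ᵥ v))
      (affineForm l p • v - ((fun i => l (Fin.succ i)) ⬝ᵥ v) • p) : Fin (n + 1) → ℝ) := by
  ext s
  refine Fin.cases ?_ (fun i => ?_) s
  · simp [meetMatrix, Matrix.mulVec, dotProduct]
  · simp only [Matrix.mulVec, dotProduct, meetMatrix, Matrix.of_apply, Fin.cons_succ, sub_mul,
      Finset.sum_sub_distrib, Pi.sub_apply, Pi.smul_apply, smul_eq_mul]
    simp [Pi.single_apply, Finset.sum_mul, mul_right_comm]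

/-- The matrix of the projection `w ↦ w - w₀ (1, p)` along the point `p`. -/
def dirMatrix {n : ℕ} (p : Fin n → ℝ) : Matrix (Fin n) (Fin (n + 1)) ℝ :=
  Matrix.of fun i => (Fin.cons (-p i) (Pi.single i 1) : Fin (n + 1) → ℝ)

theorem dirMatrix_mulVec {n : ℕ} (p : Fin n → ℝ) (w : Fin (n + 1) → ℝ) :
    dirMatrix p *ᵥ w = (fun i => w (Fin.succ i)) - w 0 • p := by
  ext i
  simp [dirMatrix, Matrix.mulVec, dotProduct, Fin.sum_univ_succ, Pi.single_apply]
  ring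

theorem ext_of_forall_mulVec {m k : Type*} [Fintype k] [DecidableEq k] {A B : Matrix m k ℝ}
    (h : ∀ v, A *ᵥ v = B *ᵥ v) : A = B := by
  ext i j
  simpa using congrFun (h (Pi.single j 1)) i

/-- Sliding a direction from p to p₀ keeps the point where its line meets the hyperplane l = 0; the
scalars also match once l is normalised at p₀. -/
theorem meetMatrix_eq_mul_slideMatrix {n : ℕ} (l : Fin (n + 1) → ℝ) (p p₀ : Fin n → ℝ)
    (h : affineForm l p₀ ≠ 0) : meetMatrix l p =
      meetMatrix l p₀ * slideMatrix ((affineForm l p₀)⁻¹ • fun i => l (Fin.succ i)) (p - p₀) := by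
  apply ext_of_forall_mulVec
  intro v
  have hl : affineForm l p =
      affineForm l p₀ + (fun i => l (Fin.succ i)) ⬝ᵥ (p - p₀) := by
    rw [affineForm_eq, affineForm_eq, dotProduct_sub]; ring
  rw [← Matrix.mulVec_mulVec, slideMatrix_mulVec, meetMatrix_mulVec, meetMatrix_mulVec, hl]
  set b := fun i => l (Fin.succ i)
  set l₀ := affineForm l p₀
  simp only [dotProduct_sub, dotProduct_smul, smul_dotProduct, smul_eq_mul]
  ext s
  refine Fin.cases ?_ (fun i => ?_) s
  · simp only [Fin.cons_zero]; field_simp; ring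
  · simp only [Fin.cons_succ, Pi.sub_apply, Pi.smul_apply, smul_eq_mul]; field_simp; ring

theorem Matrix.IsSymm.conj {m k : Type*} [Fintype m] [Fintype k] {S : Matrix m m ℝ} (hS : S.IsSymm)
    (R : Matrix m k ℝ) : (Rᵀ * S * R).IsSymm := by
  simp [Matrix.IsSymm, Matrix.transpose_mul, hS.eq, Matrix.mul_assoc]

theorem quad_conj {m k : Type*} [Fintype m] [Fintype k] (S : Matrix m m ℝ)
    (R : Matrix m k ℝ) (v w : k → ℝ) :
    v ⬝ᵥ (Rᵀ * S * R) *ᵥ w = (R *ᵥ v) ⬝ᵥ S *ᵥ (R *ᵥ w) := by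
  rw [← Matrix.mulVec_mulVec, ← Matrix.mulVec_mulVec, Matrix.dotProduct_mulVec,
    Matrix.vecMul_transpose]

theorem QuasilinearEquation.coeff_ne_zero {n : ℕ} [NeZero n] (E : QuasilinearEquation n)
    {p : Fin n → ℝ} (hp : p ∈ E.domain) : E.coeff p ≠ 0 := by
  intro h
  apply E.nondegenerate_coeff p hp
  rw [h, Matrix.det_zero]

/-- The conformal structure has a projective normal form if and only if its null cones project
to one quadric in a hyperplane. -/
theorem QuasilinearEquation.hasProjectiveNormalForm_iff {n : ℕ} [NeZero n]
    (E : QuasilinearEquation n) :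
    E.HasProjectiveNormalForm ↔ ∃ (l : Fin (n + 1) → ℝ) (S : Matrix (Fin (n + 1)) (Fin (n + 1)) ℝ),
      S.IsSymm ∧ ∀ p ∈ E.domain, affineForm l p ≠ 0 ∧ ∃ c : ℝ, c ≠ 0 ∧
        E.coeff p = c • ((meetMatrix l p)ᵀ * S * meetMatrix l p) := by
  constructor
  · rintro ⟨p₀, hp₀, a, h⟩
    -- The constant term is chosen so that l(p) = 1 + a·(p - p₀).
    set l : Fin (n + 1) → ℝ := Fin.cons (1 - a ⬝ᵥ p₀) a with hl
    have hla : (fun i => l (Fin.succ i)) = a := by ext i; simp [hl]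
    have hlp : ∀ p, affineForm l p = 1 + a ⬝ᵥ (p - p₀) := by
      intro p; rw [affineForm_eq, hla, dotProduct_sub]; simp only [hl, Fin.cons_zero]; ring
    have hNR : ∀ p, dirMatrix p₀ * meetMatrix l p = slideMatrix a (p - p₀) := by
      intro p
      apply ext_of_forall_mulVec
      intro v
      rw [← Matrix.mulVec_mulVec, meetMatrix_mulVec, dirMatrix_mulVec, slideMatrix_mulVec, hlp, hla]
      ext i
      simp
      ring
    -- S is the equation of the null cone with vertex p₀, that is, f(p₀) composed with the
    -- projection along (1, p₀).
    refine ⟨l, (dirMatrix p₀)ᵀ * E.coeff p₀ * dirMatrix p₀, (E.symm_coeff p₀ hp₀).conj _, fun p hp => ?_⟩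
    obtain ⟨h1, c, hc, h2⟩ := h p hp
    refine ⟨by rwa [hlp], c, hc, ?_⟩
    rw [h2, ← hNR, Matrix.transpose_mul]
    simp only [Matrix.mul_assoc]
  · rintro ⟨l, S, hS, h⟩
    obtain ⟨p₀, hp₀⟩ := E.nonempty_domain
    obtain ⟨h0, c₀, hc₀, h1⟩ := h p₀ hp₀
    refine ⟨p₀, hp₀, (affineForm l p₀)⁻¹ • fun i => l (Fin.succ i), fun p hp => ?_⟩
    obtain ⟨h2, c, hc, h3⟩ := h p hp
    have hl : affineForm l p =
        affineForm l p₀ + (fun i => l (Fin.succ i)) ⬝ᵥ (p - p₀) := by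
      rw [affineForm_eq, affineForm_eq, dotProduct_sub]; ring
    refine ⟨?_, c / c₀, div_ne_zero hc hc₀, ?_⟩
    · intro h4
      apply h2
      rw [smul_dotProduct, smul_eq_mul] at h4
      rw [hl]
      field_simp at h4
      simpa using h4
    · rw [h3, meetMatrix_eq_mul_slideMatrix l p p₀ h0, Matrix.transpose_mul, h1]
      simp only [Matrix.mul_smul, Matrix.smul_mul, smul_smul, div_mul_cancel₀ _ hc₀,
        Matrix.mul_assoc]

/-! ### Gradients and Hessians -/

theorem fderiv_apply_eq_grad {n : ℕ} (f : (Fin n → ℝ) → ℝ) (x w : Fin n → ℝ) :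
    fderiv ℝ f x w = grad f x ⬝ᵥ w := by
  conv_lhs => rw [pi_eq_sum_univ' w]
  simp [grad, dotProduct, mul_comm]

theorem grad_eq_of_hasDerivAt {n : ℕ} {f : (Fin n → ℝ) → ℝ} {x : Fin n → ℝ} {i : Fin n} {d : ℝ}
    (hf : DifferentiableAt ℝ f x)
    (h : HasDerivAt (fun t : ℝ => f (x + t • Pi.single i 1)) d 0) : grad f x i = d := by
  rw [grad, ← hf.lineDeriv_eq_fderiv]
  exact h.deriv

theorem grad_congr {n : ℕ} {f g : (Fin n → ℝ) → ℝ} {x : Fin n → ℝ} (h : f =ᶠ[𝓝 x] g) :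
    grad f x = grad g x := by
  ext i; simp only [grad, h.fderiv_eq]

theorem contDiffAt_grad {n : ℕ} {m : WithTop ℕ∞} {u : (Fin n → ℝ) → ℝ} {x : Fin n → ℝ}
    (hu : ContDiffAt ℝ (m + 1) u x) (i : Fin n) : ContDiffAt ℝ m (fun y => grad u y i) x :=
  (hu.fderiv_right le_rfl).clm_apply contDiffAt_const

theorem differentiableAt_grad {n : ℕ} {u : (Fin n → ℝ) → ℝ} {x : Fin n → ℝ}
    (hu : ContDiffAt ℝ 2 u x) : DifferentiableAt ℝ (grad u) x :=
  differentiableAt_pi.2 fun i =>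
    (contDiffAt_grad (m := 1) (by simpa [one_add_one_eq_two] using hu) i).differentiableAt (by simp)

theorem grad_comp {n m : ℕ} {g : (Fin m → ℝ) → ℝ} {F : (Fin n → ℝ) → Fin m → ℝ} {x : Fin n → ℝ}
    (hg : DifferentiableAt ℝ g (F x)) (hF : DifferentiableAt ℝ F x) (i : Fin n) :
    grad (fun y => g (F y)) x i = ∑ j, grad g (F x) j * grad (fun y => F y j) x i := by
  have h1 : fderiv ℝ (fun y => g (F y)) x = (fderiv ℝ g (F x)).comp (fderiv ℝ F x) :=
    fderiv_comp x hg hF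
  rw [grad, h1, ContinuousLinearMap.comp_apply, fderiv_apply_eq_grad, dotProduct]
  refine Finset.sum_congr rfl fun j _ => ?_
  rw [grad, grad, fderiv_apply hF]
  rfl

theorem isSymm_hess {n : ℕ} {u : (Fin n → ℝ) → ℝ} {x : Fin n → ℝ} (hu : ContDiffAt ℝ 2 u x) :
    (hess u x).IsSymm := by
  have hd : DifferentiableAt ℝ (fderiv ℝ u) x :=
    (hu.fderiv_right (m := 1) (by simp [one_add_one_eq_two])).differentiableAt (by simp)
  have key : ∀ i j, hess u x i j = fderiv ℝ (fderiv ℝ u) x (Pi.single i 1) (Pi.single j 1) := by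
    intro i j
    simp only [hess, Matrix.of_apply, grad]
    rw [fderiv_clm_apply hd (differentiableAt_const _)]
    simp
  ext i j
  rw [Matrix.transpose_apply, key, key]
  exact hu.isSymmSndFDerivAt (by simp) _ _

/-- The quadratic polynomial `p · x + ½ xᵀ H x`. -/
noncomputable def quadPoly {n : ℕ} (p : Fin n → ℝ) (H : Matrix (Fin n) (Fin n) ℝ) (x : Fin n → ℝ) : ℝ :=
  p ⬝ᵥ x + 2⁻¹ * (x ⬝ᵥ H *ᵥ x)

theorem contDiff_dotProduct {n m : ℕ} {k : WithTop ℕ∞} {F G : (Fin n → ℝ) → Fin m → ℝ}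
    (hF : ContDiff ℝ k F) (hG : ContDiff ℝ k G) : ContDiff ℝ k fun x => F x ⬝ᵥ G x := by
  simp only [dotProduct]
  exact ContDiff.sum fun i _ => (contDiff_pi.1 hF i).mul (contDiff_pi.1 hG i)

theorem contDiff_mulVec {n m k : ℕ} {r : WithTop ℕ∞} (A : Matrix (Fin k) (Fin m) ℝ)
    {F : (Fin n → ℝ) → Fin m → ℝ} (hF : ContDiff ℝ r F) : ContDiff ℝ r fun x => A *ᵥ F x :=
  contDiff_pi.2 fun _ => contDiff_dotProduct contDiff_const hF

theorem contDiff_quadPoly {n : ℕ} {k : WithTop ℕ∞} (p : Fin n → ℝ) (H : Matrix (Fin n) (Fin n) ℝ) :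
    ContDiff ℝ k (quadPoly p H) :=
  (contDiff_dotProduct contDiff_const contDiff_id).add
    (contDiff_const.mul (contDiff_dotProduct contDiff_id (contDiff_mulVec H contDiff_id)))

theorem grad_quadPoly {n : ℕ} (p : Fin n → ℝ) {H : Matrix (Fin n) (Fin n) ℝ} (hH : H.IsSymm)
    (x : Fin n → ℝ) : grad (quadPoly p H) x = p + H *ᵥ x := by
  ext i
  apply grad_eq_of_hasDerivAt ((contDiff_quadPoly (k := 1) p H).differentiable (by simp) x)
  have h1 : (fun t : ℝ => quadPoly p H (x + t • Pi.single i 1)) =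
      fun t => quadPoly p H x + t * (p i + (H *ᵥ x) i) + t ^ 2 * (2⁻¹ * H i i) := by
    ext t
    have := dotProduct_mulVec_comm hH x (Pi.single i 1)
    simp only [quadPoly, Matrix.mulVec_add, Matrix.mulVec_smul, dotProduct_add, add_dotProduct,
      dotProduct_smul, smul_dotProduct, smul_eq_mul, this]
    simp
    ring
  rw [h1]
  have h2 := (((hasDerivAt_id (0 : ℝ)).mul_const (p i + (H *ᵥ x) i)).const_add
    (quadPoly p H x)).fun_add ((hasDerivAt_pow 2 (0 : ℝ)).mul_const (2⁻¹ * H i i))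
  exact h2.congr_deriv (by simp)

theorem hess_quadPoly {n : ℕ} (p : Fin n → ℝ) {H : Matrix (Fin n) (Fin n) ℝ} (hH : H.IsSymm)
    (x : Fin n → ℝ) : hess (quadPoly p H) x = H := by
  ext i j
  simp only [hess, Matrix.of_apply, grad_quadPoly p hH]
  have hd : ContDiff ℝ 1 (fun y : Fin n → ℝ => (p + H *ᵥ y) j) :=
    contDiff_const.add (contDiff_dotProduct contDiff_const contDiff_id)
  apply grad_eq_of_hasDerivAt (hd.differentiable (by simp) x)
  have h1 : (fun t : ℝ => (p + H *ᵥ (x + t • Pi.single i 1)) j) =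
      fun t => (p + H *ᵥ x) j + t * H j i := by
    ext t
    simp [Matrix.mulVec_add, Matrix.mulVec_smul]
    ring
  rw [h1, ← hH.apply i j]
  simpa using ((hasDerivAt_id (0 : ℝ)).mul_const (H j i)).const_add ((p + H *ᵥ x) j)

/-! ### Euler–Lagrange equations -/

theorem eulerLagrange_eq {n : ℕ} {g u : (Fin n → ℝ) → ℝ} {x : Fin n → ℝ}
    (hg : ContDiffAt ℝ 2 g (grad u x)) (hu : ContDiffAt ℝ 2 u x) :
    eulerLagrange g u x = ∑ i, ∑ j, hess g (grad u x) i j * hess u x i j := by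
  have hs := isSymm_hess hg
  refine Finset.sum_congr rfl fun i _ => ?_
  rw [grad_comp (g := fun q => grad g q i) (differentiableAt_pi.1 (differentiableAt_grad hg) i)
    (differentiableAt_grad hu)]
  refine Finset.sum_congr rfl fun j _ => ?_
  rw [← hs.apply i j]
  rfl

/-- The Euler–Lagrange expression is the trace pairing of the Hessians of g and u. Testing on
quadratic polynomials shows that f(p) and the Hessian of g at p have the same symmetric annihilator.
-/
theorem QuasilinearEquation.isLagrangianWithDensity_iff {n : ℕ} [NeZero n]
    (E : QuasilinearEquation n) {g : (Fin n → ℝ) → ℝ} (hg : ContDiffOn ℝ ∞ g E.domain) :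
    E.IsLagrangianWithDensity g ↔
      ∀ p ∈ E.domain, ∃ c : ℝ, c ≠ 0 ∧ E.coeff p = c • hess g p := by
  have hg2 : ∀ p ∈ E.domain, ContDiffAt ℝ 2 g p := fun p hp =>
    ((hg p hp).contDiffAt (E.isOpen_domain.mem_nhds hp)).of_le (WithTop.coe_le_coe.2 le_top)
  constructor
  · rintro ⟨-, h⟩ p hp
    obtain ⟨c, hc, h1⟩ := exists_eq_smul_of_annihilator (isSymm_hess (hg2 p hp))
      (E.symm_coeff p hp) (E.coeff_ne_zero hp) fun H hH => by
        have hp' : grad (quadPoly p H) 0 = p := by simp [grad_quadPoly p hH]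
        have := h (quadPoly p H) 0 (contDiff_quadPoly p H).contDiffAt (by rwa [hp'])
        rw [eulerLagrange_eq (by rw [hp']; exact hg2 p hp) (contDiff_quadPoly p H).contDiffAt,
          hess_quadPoly p hH, QuasilinearEquation.HoldsAt, SatisfiesAt, hp',
          hess_quadPoly p hH] at this
        exact this.symm
    exact ⟨c⁻¹, inv_ne_zero hc, by rw [h1, smul_smul, inv_mul_cancel₀ hc, one_smul]⟩
  · intro h
    refine ⟨hg, fun u x hu hx => ?_⟩
    obtain ⟨c, hc, h1⟩ := h _ hx
    rw [eulerLagrange_eq (hg2 _ hx) hu, QuasilinearEquation.HoldsAt, SatisfiesAt, h1]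
    simp only [Matrix.smul_apply, smul_eq_mul, mul_assoc, ← Finset.mul_sum]
    simp [hc]

/-! ### Densities of the form quadratic over linear -/

theorem contDiff_cons_one {n : ℕ} {k : WithTop ℕ∞} :
    ContDiff ℝ k (fun p : Fin n → ℝ => (Fin.cons 1 p : Fin (n + 1) → ℝ)) := by
  refine contDiff_pi.2 fun s => ?_
  refine Fin.cases ?_ (fun i => ?_) s
  · simpa using contDiff_const
  · simpa using contDiff_apply ℝ ℝ i

theorem contDiff_affineForm {n : ℕ} {k : WithTop ℕ∞} (l : Fin (n + 1) → ℝ) :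
    ContDiff ℝ k (affineForm l) :=
  contDiff_dotProduct contDiff_const contDiff_cons_one

theorem contDiff_affineQuadraticForm {n : ℕ} {k : WithTop ℕ∞}
    (Q : Matrix (Fin (n + 1)) (Fin (n + 1)) ℝ) : ContDiff ℝ k (affineQuadraticForm Q) :=
  contDiff_dotProduct contDiff_cons_one (contDiff_mulVec Q contDiff_cons_one)

theorem cons_one_add_smul_single {n : ℕ} (p : Fin n → ℝ) (t : ℝ) (i : Fin n) :
    (Fin.cons 1 (p + t • Pi.single i 1) : Fin (n + 1) → ℝ) =
      Fin.cons 1 p + t • Pi.single i.succ 1 := by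
  ext s
  refine Fin.cases ?_ (fun j => ?_) s
  · simp [(Fin.succ_ne_zero i).symm]
  · simp [Pi.single_apply]

theorem affineForm_add_smul_single {n : ℕ} (l : Fin (n + 1) → ℝ) (p : Fin n → ℝ) (t : ℝ)
    (i : Fin n) : affineForm l (p + t • Pi.single i 1) = affineForm l p + t * l i.succ := by
  simp [affineForm, cons_one_add_smul_single, dotProduct_add]

theorem grad_quadratic_div_linear {n : ℕ} {Q : Matrix (Fin (n + 1)) (Fin (n + 1)) ℝ}
    (hQ : Q.IsSymm) {l : Fin (n + 1) → ℝ} {p : Fin n → ℝ} (hp : affineForm l p ≠ 0) (i : Fin n) :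
    grad (fun q => affineQuadraticForm Q q / affineForm l q) p i =
      2 * (Q *ᵥ (Fin.cons 1 p : Fin (n + 1) → ℝ)) i.succ / affineForm l p -
        affineQuadraticForm Q p * l i.succ / affineForm l p ^ 2 := by
  apply grad_eq_of_hasDerivAt
  · exact ((contDiff_affineQuadraticForm (k := 1) Q).contDiffAt.div
      (contDiff_affineForm (k := 1) l).contDiffAt hp).differentiableAt (by simp)
  set P := (Fin.cons 1 p : Fin (n + 1) → ℝ) with hP
  have h1 : ∀ t : ℝ, affineQuadraticForm Q (p + t • Pi.single i 1) = affineQuadraticForm Q p +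
      t * (2 * (Q *ᵥ P) i.succ) + t ^ 2 * Q i.succ i.succ := by
    intro t
    have := dotProduct_mulVec_comm hQ P (Pi.single i.succ 1)
    simp only [affineQuadraticForm, cons_one_add_smul_single, ← hP, Matrix.mulVec_add,
      Matrix.mulVec_smul, dotProduct_add, add_dotProduct, dotProduct_smul, smul_dotProduct,
      smul_eq_mul, this]
    simp
    ring
  simp only [h1, affineForm_add_smul_single]
  have h2 := (((hasDerivAt_id (0 : ℝ)).mul_const (2 * (Q *ᵥ P) i.succ)).const_add
    (affineQuadraticForm Q p)).fun_add ((hasDerivAt_pow 2 (0 : ℝ)).mul_const (Q i.succ i.succ))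
  have h3 := ((hasDerivAt_id (0 : ℝ)).mul_const (l i.succ)).const_add (affineForm l p)
  refine (h2.fun_div h3 (by simpa using hp)).congr_deriv ?_
  simp
  field_simp

/-- Behind the formula: Q/l is homogeneous of degree one in P = (1, p), so its Hessian in the
homogeneous coordinates kills P, and on vectors w with l(w) = 0 it equals 2 Q(w, w)/l. Modulo P, the
vector (0, v) is 1/l(p) times the column combination `meetMatrix l p *ᵥ v`, which lies in l = 0;
this accounts for the factor 2/l³. -/
theorem hess_quadratic_div_linear {n : ℕ} {Q : Matrix (Fin (n + 1)) (Fin (n + 1)) ℝ}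
    (hQ : Q.IsSymm) {l : Fin (n + 1) → ℝ} {p : Fin n → ℝ} (hp : affineForm l p ≠ 0) :
    hess (fun q => affineQuadraticForm Q q / affineForm l q) p =
      (2 / affineForm l p ^ 3) • ((meetMatrix l p)ᵀ * Q * meetMatrix l p) := by
  ext i j
  set P := (Fin.cons 1 p : Fin (n + 1) → ℝ) with hP
  have hcol : ∀ j, meetMatrix l p *ᵥ Pi.single j 1 =
      affineForm l p • Pi.single j.succ 1 - l j.succ • P := by
    intro j
    rw [meetMatrix_mulVec]
    ext s
    refine Fin.cases ?_ (fun k => ?_) s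
    · simp [hP, (Fin.succ_ne_zero j).symm]
    · simp [hP, Pi.single_apply]
  have hR : ((meetMatrix l p)ᵀ * Q * meetMatrix l p) i j =
      affineForm l p ^ 2 * Q i.succ j.succ
        - affineForm l p * l j.succ * (Q *ᵥ P) i.succ - affineForm l p * l i.succ * (Q *ᵥ P) j.succ
        + l i.succ * l j.succ * affineQuadraticForm Q p := by
    have h1 := quad_conj Q (meetMatrix l p) (Pi.single i 1) (Pi.single j 1)
    have h2 := dotProduct_mulVec_comm hQ P (Pi.single j.succ 1)
    simp only [hcol, Matrix.mulVec_sub, Matrix.mulVec_smul, dotProduct_sub, sub_dotProduct,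
      dotProduct_smul, smul_dotProduct, smul_eq_mul, h2] at h1
    simp only [Matrix.mulVec_single_one, single_one_dotProduct, Matrix.col_apply] at h1
    rw [h1, affineQuadraticForm]
    ring
  have hl : ContDiff ℝ 1 (affineForm l) := contDiff_affineForm l
  have hne : ∀ᶠ q in 𝓝 p, affineForm l q ≠ 0 := hl.continuous.continuousAt.eventually_ne hp
  rw [Matrix.smul_apply, hR, smul_eq_mul]
  simp only [hess, Matrix.of_apply]
  rw [grad_congr (hne.mono fun q hq => grad_quadratic_div_linear hQ hq j)]
  have hQd : ContDiff ℝ 1 fun q : Fin n → ℝ => (Q *ᵥ (Fin.cons 1 q : Fin (n + 1) → ℝ)) j.succ :=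
    contDiff_dotProduct contDiff_const contDiff_cons_one
  have hQ2 : ContDiff ℝ 1 (affineQuadraticForm Q) := contDiff_affineQuadraticForm Q
  apply grad_eq_of_hasDerivAt
  · exact (((contDiff_const.mul hQd).contDiffAt.div hl.contDiffAt hp).sub
      ((hQ2.mul contDiff_const).contDiffAt.div (hl.pow 2).contDiffAt
        (pow_ne_zero 2 hp))).differentiableAt (by simp)
  have h1 : ∀ t : ℝ, affineQuadraticForm Q (p + t • Pi.single i 1) = affineQuadraticForm Q p +
      t * (2 * (Q *ᵥ P) i.succ) + t ^ 2 * Q i.succ i.succ := by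
    intro t
    have := dotProduct_mulVec_comm hQ P (Pi.single i.succ 1)
    simp only [affineQuadraticForm, cons_one_add_smul_single, ← hP, Matrix.mulVec_add,
      Matrix.mulVec_smul, dotProduct_add, add_dotProduct, dotProduct_smul, smul_dotProduct,
      smul_eq_mul, this]
    simp
    ring
  have h1' : ∀ t : ℝ, (Q *ᵥ (Fin.cons 1 (p + t • Pi.single i 1) : Fin (n + 1) → ℝ)) j.succ =
      (Q *ᵥ P) j.succ + t * Q i.succ j.succ := by
    intro t
    rw [cons_one_add_smul_single, Matrix.mulVec_add, Matrix.mulVec_smul, ← hP,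
      ← hQ.apply i.succ j.succ]
    simp
  simp only [h1, h1', affineForm_add_smul_single]
  have h2 := (((hasDerivAt_id (0 : ℝ)).mul_const (2 * (Q *ᵥ P) i.succ)).const_add
    (affineQuadraticForm Q p)).fun_add ((hasDerivAt_pow 2 (0 : ℝ)).mul_const (Q i.succ i.succ))
  have h3 := ((hasDerivAt_id (0 : ℝ)).mul_const (l i.succ)).const_add (affineForm l p)
  have h4 := ((hasDerivAt_id (0 : ℝ)).mul_const (Q i.succ j.succ)).const_add ((Q *ᵥ P) j.succ)
  refine (((h4.const_mul 2).fun_div h3 (by simpa using hp)).fun_sub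
    ((h2.mul_const (l j.succ)).fun_div (h3.fun_pow 2) (by simpa using hp))).congr_deriv ?_
  simp
  field_simp
  ring

theorem QuasilinearEquation.isLagrangianQuadraticOverLinear_iff {n : ℕ} [NeZero n]
    (E : QuasilinearEquation n) :
    E.IsLagrangianQuadraticOverLinear ↔ E.HasProjectiveNormalForm := by
  have hsm : ∀ (Q : Matrix (Fin (n + 1)) (Fin (n + 1)) ℝ) (l : Fin (n + 1) → ℝ),
      (∀ p ∈ E.domain, affineForm l p ≠ 0) →
      ContDiffOn ℝ ∞ (fun p => affineQuadraticForm Q p / affineForm l p) E.domain := fun Q l h =>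
    (contDiff_affineQuadraticForm Q).contDiffOn.div (contDiff_affineForm l).contDiffOn h
  rw [E.hasProjectiveNormalForm_iff]
  constructor
  · rintro ⟨Q, l, hQ, hl, h⟩
    refine ⟨l, Q, hQ, fun p hp => ⟨hl p hp, ?_⟩⟩
    obtain ⟨c, hc, h1⟩ := (E.isLagrangianWithDensity_iff (hsm Q l hl)).1 h p hp
    rw [hess_quadratic_div_linear hQ (hl p hp), smul_smul] at h1
    exact ⟨_, mul_ne_zero hc (div_ne_zero two_ne_zero (pow_ne_zero 3 (hl p hp))), h1⟩
  · rintro ⟨l, Q, hQ, h⟩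
    have hl := fun p hp => (h p hp).1
    refine ⟨Q, l, hQ, hl, (E.isLagrangianWithDensity_iff (hsm Q l hl)).2 fun p hp => ?_⟩
    obtain ⟨h0, c, hc, h1⟩ := h p hp
    refine ⟨c * (affineForm l p ^ 3 / 2), by positivity, ?_⟩
    rw [h1, hess_quadratic_div_linear hQ h0, smul_smul]
    congr 1
    field_simp

/-! ### The action of the equivalence group on second derivatives -/

namespace EquivalenceGroup

variable {n : ℕ} (T : EquivalenceGroup n)

theorem newX_apply (u : (Fin n → ℝ) → ℝ) (y : Fin n → ℝ) (i : Fin n) :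
    T.newX u y i = (fun j => T.1 (Sum.inl i) (Sum.inl j)) ⬝ᵥ y +
      T.1 (Sum.inl i) (Sum.inr ()) * u y := by
  simp [newX, image, Matrix.mulVec, dotProduct, Fintype.sum_sum_type]

theorem newU_apply (u : (Fin n → ℝ) → ℝ) (y : Fin n → ℝ) :
    T.newU u y = (fun j => T.1 (Sum.inr ()) (Sum.inl j)) ⬝ᵥ y +
      T.1 (Sum.inr ()) (Sum.inr ()) * u y := by
  simp [newU, image, Matrix.mulVec, dotProduct, Fintype.sum_sum_type]

theorem contDiffAt_newX {k : WithTop ℕ∞} {u : (Fin n → ℝ) → ℝ} {x : Fin n → ℝ}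
    (hu : ContDiffAt ℝ k u x) : ContDiffAt ℝ k (T.newX u) x := by
  refine contDiffAt_pi.2 fun i => ?_
  simp only [newX_apply]
  exact (contDiff_dotProduct contDiff_const contDiff_id).contDiffAt.add (contDiffAt_const.mul hu)

theorem contDiffAt_newU {k : WithTop ℕ∞} {u : (Fin n → ℝ) → ℝ} {x : Fin n → ℝ}
    (hu : ContDiffAt ℝ k u x) : ContDiffAt ℝ k (T.newU u) x := by
  have : T.newU u = fun y => _ := funext fun y => newU_apply T u y
  rw [this]
  exact (contDiff_dotProduct contDiff_const contDiff_id).contDiffAt.add (contDiffAt_const.mul hu)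

theorem grad_dotProduct_add_mul {u : (Fin n → ℝ) → ℝ} {y : Fin n → ℝ}
    (hu : DifferentiableAt ℝ u y) (c : Fin n → ℝ) (b : ℝ) (j : Fin n) :
    grad (fun z => c ⬝ᵥ z + b * u z) y j = c j + b * grad u y j := by
  have h1 : DifferentiableAt ℝ (fun z : Fin n → ℝ => c ⬝ᵥ z) y :=
    (contDiff_dotProduct (k := 1) contDiff_const contDiff_id).differentiable (by simp) y
  have h2 : grad (fun z : Fin n → ℝ => c ⬝ᵥ z) y j = c j := by
    apply grad_eq_of_hasDerivAt h1
    simp only [dotProduct_add, dotProduct_smul, smul_eq_mul, dotProduct_single_one]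
    simpa using ((hasDerivAt_id (0 : ℝ)).mul_const (c j)).const_add (c ⬝ᵥ y)
  rw [← h2, grad, grad, grad, fderiv_fun_add h1 (hu.const_mul b), fderiv_const_mul hu]
  rfl

theorem grad_newX {u : (Fin n → ℝ) → ℝ} {y : Fin n → ℝ} (hu : DifferentiableAt ℝ u y)
    (i j : Fin n) : grad (fun z => T.newX u z i) y j = T.jacobian (grad u y) i j := by
  simp only [newX_apply]
  rw [grad_dotProduct_add_mul hu]
  rfl

/-- The derivatives of a solution and of its image under `T`. -/
theorem eventually_grad_newX {u u' : (Fin n → ℝ) → ℝ} {x : Fin n → ℝ} (hu : ContDiffAt ℝ 2 u x)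
    (hu' : ContDiffAt ℝ 2 u' (T.newX u x)) (h : T.MapsGraph u u' x) :
    ∀ᶠ y in 𝓝 x, ∀ j, ∑ i, grad u' (T.newX u y) i * T.jacobian (grad u y) i j =
      T.1 (Sum.inr ()) (Sum.inl j) + T.1 (Sum.inr ()) (Sum.inr ()) * grad u y j := by
  have h1 : ∀ᶠ y in 𝓝 x, ContDiffAt ℝ 2 u' (T.newX u y) :=
    (T.contDiffAt_newX hu).continuousAt.eventually (hu'.eventually (by simp))
  filter_upwards [h1, hu.eventually (by simp), h.eventually_nhds] with y hy' hy he j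
  have hd : DifferentiableAt ℝ u y := hy.differentiableAt (by simp)
  have h2 := congrFun (grad_congr he) j
  rw [grad_comp (hy'.differentiableAt (by simp)) ((T.contDiffAt_newX hy).differentiableAt
    (by simp))] at h2
  simp only [T.grad_newX hd] at h2
  have h3 : T.newU u = fun z => _ := funext fun z => newU_apply T u z
  rw [h2, h3, grad_dotProduct_add_mul hd]

theorem grad_mul {f g : (Fin n → ℝ) → ℝ} {x : Fin n → ℝ} (hf : DifferentiableAt ℝ f x)
    (hg : DifferentiableAt ℝ g x) (k : Fin n) :
    grad (fun y => f y * g y) x k = f x * grad g x k + g x * grad f x k := by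
  simp [grad, fderiv_fun_mul hf hg]

theorem grad_sum {ι : Type*} [Fintype ι] {f : ι → (Fin n → ℝ) → ℝ} {x : Fin n → ℝ}
    (hf : ∀ i, DifferentiableAt ℝ (f i) x) (k : Fin n) :
    grad (fun y => ∑ i, f i y) x k = ∑ i, grad (f i) x k := by
  simp [grad, fderiv_fun_sum fun i _ => hf i]

theorem grad_const_add_mul {f : (Fin n → ℝ) → ℝ} {x : Fin n → ℝ} (hf : DifferentiableAt ℝ f x)
    (c b : ℝ) (k : Fin n) : grad (fun y => c + b * f y) x k = b * grad f x k := by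
  simp [grad, fderiv_const_mul hf]

/-- The transformation law of the Hessian. -/
theorem exists_hess_eq {u u' : (Fin n → ℝ) → ℝ} {x : Fin n → ℝ} (hu : ContDiffAt ℝ 2 u x)
    (hu' : ContDiffAt ℝ 2 u' (T.newX u x)) (h : T.MapsGraph u u' x) :
    ∃ s : ℝ, s ≠ 0 ∧ (T.jacobian (grad u x))ᵀ * hess u' (T.newX u x) * T.jacobian (grad u x) =
      s • hess u x := by
  have hev := T.eventually_grad_newX hu hu' h
  set q := grad u' (T.newX u x) with hq
  set b : Fin n → ℝ := fun i => T.1 (Sum.inl i) (Sum.inr ()) with hb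
  set β := T.1 (Sum.inr ()) (Sum.inr ()) with hβ
  -- Differentiating q J = c + β p once more produces β H on the right and (q·b) H from the
  -- derivative of J on the left. If the difference β - q·b vanished, the nonzero row (q, -1) would
  -- be killed by the invertible matrix T.
  refine ⟨β - ∑ i, q i * b i, ?_, ?_⟩
  · intro hs
    have h0 := hev.self_of_nhds
    have hz : (Sum.elim q (fun _ : Unit => (-1 : ℝ))) ᵥ* T.1 = 0 := by
      ext s
      rcases s with j | ⟨⟩
      · have := h0 j
        simp only [jacobian, Matrix.of_apply, mul_add, Finset.sum_add_distrib] at this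
        have h1 : ∑ i, q i * (T.1 (Sum.inl i) (Sum.inr ()) * grad u x j) =
            (∑ i, q i * b i) * grad u x j := by
          rw [Finset.sum_mul]; exact Finset.sum_congr rfl fun i _ => by rw [hb]; ring
        simp only [Matrix.vecMul, dotProduct, Fintype.sum_sum_type, Sum.elim_inl, Sum.elim_inr,
          Finset.univ_unique, Finset.sum_singleton, Pi.zero_apply]
        rw [← hq, h1] at this
        simp only [PUnit.default_eq_unit]
        linear_combination this + hs * grad u x j
      · simp only [Matrix.vecMul, dotProduct, Fintype.sum_sum_type, Sum.elim_inl, Sum.elim_inr,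
          Finset.univ_unique, Finset.sum_singleton, Pi.zero_apply, PUnit.default_eq_unit]
        linear_combination -hs
    have := congrFun (Matrix.eq_zero_of_vecMul_eq_zero (by rw [T.2]; exact one_ne_zero) hz)
      (Sum.inr ())
    simp at this
  · ext k j
    have hgu : ∀ i, DifferentiableAt ℝ (fun y => grad u y i) x :=
      differentiableAt_pi.1 (differentiableAt_grad hu)
    have hX : DifferentiableAt ℝ (T.newX u) x := (T.contDiffAt_newX hu).differentiableAt (by simp)
    have hgu' : ∀ i, DifferentiableAt ℝ (fun z => grad u' z i) (T.newX u x) :=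
      differentiableAt_pi.1 (differentiableAt_grad hu')
    have hF : ∀ i, DifferentiableAt ℝ (fun y => grad u' (T.newX u y) i) x := fun i =>
      (hgu' i).comp x hX
    have hJ : ∀ i, DifferentiableAt ℝ (fun y => T.jacobian (grad u y) i j) x := fun i =>
      ((hgu j).const_mul _).const_add _
    have h1 := congrFun (grad_congr (hev.mono fun y hy => hy j)) k
    rw [grad_const_add_mul (hgu j), grad_sum (fun i => (hF i).fun_mul (hJ i))] at h1
    have h2 : ∀ i, grad (fun y => grad u' (T.newX u y) i * T.jacobian (grad u y) i j) x k =
        q i * (b i * hess u x k j) + (∑ m, T.jacobian (grad u x) m k *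
          hess u' (T.newX u x) m i) * T.jacobian (grad u x) i j := by
      intro i
      rw [grad_mul (hF i) (hJ i), grad_comp (g := fun z => grad u' z i) (hgu' i) hX]
      simp only [T.grad_newX (hu.differentiableAt (by simp))]
      rw [show grad (fun y => T.jacobian (grad u y) i j) x k = b i * hess u x k j from
        grad_const_add_mul (hgu j) _ _ k, mul_comm (T.jacobian (grad u x) i j)]
      congr 2
      exact Finset.sum_congr rfl fun m _ => mul_comm _ _
    simp only [h2, Finset.sum_add_distrib] at h1
    rw [Matrix.mul_apply, Matrix.smul_apply, smul_eq_mul]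
    simp only [Matrix.mul_apply, Matrix.transpose_apply]
    have h3 : ∑ i, q i * (b i * hess u x k j) = (∑ i, q i * b i) * hess u x k j := by
      rw [Finset.sum_mul]; exact Finset.sum_congr rfl fun i _ => by ring
    rw [h3] at h1
    change _ = β * hess u x k j at h1
    linear_combination h1

theorem sum_mul_eq_trace {m : Type*} [Fintype m] (A H : Matrix m m ℝ) :
    ∑ i, ∑ j, A i j * H i j = (A * Hᵀ).trace := by
  simp [Matrix.trace, Matrix.mul_apply]

/-- The Hessian of the image is s J⁻ᵀ H J⁻¹; cyclicity of the trace moves both Jacobians onto A, and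
the nonzero s drops out. -/
theorem satisfiesAt_iff {u u' : (Fin n → ℝ) → ℝ} {x : Fin n → ℝ} (hu : ContDiffAt ℝ 2 u x)
    (hu' : ContDiffAt ℝ 2 u' (T.newX u x)) (h : T.MapsGraph u u' x)
    (hJ : (T.jacobian (grad u x)).det ≠ 0) (A : Matrix (Fin n) (Fin n) ℝ) :
    SatisfiesAt A u' (T.newX u x) ↔ SatisfiesAt
      ((T.jacobian (grad u x))⁻¹ * A * ((T.jacobian (grad u x))⁻¹)ᵀ) u x := by
  obtain ⟨s, hs, h1⟩ := T.exists_hess_eq hu hu' h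
  set J := T.jacobian (grad u x)
  have hu1 : IsUnit J.det := isUnit_iff_ne_zero.2 hJ
  have h2 : hess u' (T.newX u x) = s • ((J⁻¹)ᵀ * hess u x * J⁻¹) := by
    have h3 : (J⁻¹)ᵀ * Jᵀ = 1 := by
      rw [← Matrix.transpose_mul, Matrix.mul_nonsing_inv _ hu1, Matrix.transpose_one]
    calc hess u' (T.newX u x) = ((J⁻¹)ᵀ * Jᵀ) * hess u' (T.newX u x) * (J * J⁻¹) := by
          rw [h3, Matrix.mul_nonsing_inv _ hu1, Matrix.one_mul, Matrix.mul_one]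
      _ = (J⁻¹)ᵀ * (Jᵀ * hess u' (T.newX u x) * J) * J⁻¹ := by simp only [Matrix.mul_assoc]
      _ = _ := by rw [h1]; simp
  rw [SatisfiesAt, SatisfiesAt, sum_mul_eq_trace, sum_mul_eq_trace, h2]
  simp only [Matrix.transpose_smul, Matrix.transpose_mul, Matrix.transpose_transpose,
    Matrix.mul_smul, Matrix.trace_smul, smul_eq_mul, mul_eq_zero, hs, false_or]
  rw [← Matrix.mul_assoc, Matrix.trace_mul_comm]
  simp only [Matrix.mul_assoc]
  rw [← Matrix.mul_assoc A, Matrix.trace_mul_comm]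
  simp only [Matrix.mul_assoc]

/-- Any two-jet at which `T` is regular is the jet of a function whose graph is mapped by `T` to a
graph again. -/
theorem exists_mapsGraph {p : Fin n → ℝ} (hJ : (T.jacobian p).det ≠ 0)
    {H : Matrix (Fin n) (Fin n) ℝ} (hH : H.IsSymm) :
    ∃ u', ContDiffAt ℝ 2 u' (T.newX (quadPoly p H) 0) ∧ T.MapsGraph (quadPoly p H) u' 0 := by
  have hu : ContDiffAt ℝ 2 (quadPoly p H) 0 := (contDiff_quadPoly p H).contDiffAt
  have hX := T.contDiffAt_newX hu
  have hp : grad (quadPoly p H) 0 = p := by simp [grad_quadPoly p hH]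
  let e : (Fin n → ℝ) ≃L[ℝ] (Fin n → ℝ) := ((T.jacobian p).toLinearEquiv'
    (Matrix.invertibleOfIsUnitDet _ (isUnit_iff_ne_zero.2 hJ))).toContinuousLinearEquiv
  have he : ∀ w, e w = T.jacobian p *ᵥ w := fun w => rfl
  have hd : HasFDerivAt (T.newX (quadPoly p H)) (e : (Fin n → ℝ) →L[ℝ] (Fin n → ℝ)) 0 := by
    have h1 : DifferentiableAt ℝ (T.newX (quadPoly p H)) 0 := hX.differentiableAt (by simp)
    convert h1.hasFDerivAt using 1
    ext w i
    have h2 := DFunLike.congr_fun (fderiv_apply h1 i) w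
    refine Eq.trans ?_ h2
    rw [fderiv_apply_eq_grad, dotProduct]
    change ∑ j, T.jacobian p i j * w j = _
    refine Finset.sum_congr rfl fun j _ => ?_
    rw [T.grad_newX (hu.differentiableAt (by simp)), hp]
  -- The derivative of `newX` at 0 is J(p), which is invertible, so the inverse function theorem
  -- lets the new dependent variable be written as a function of the new independent ones.
  refine ⟨fun z => T.newU (quadPoly p H) (hX.localInverse hd (by simp) z), ?_, ?_⟩
  · exact ContDiffAt.comp (g := T.newU (quadPoly p H)) _
      (T.contDiffAt_newU (contDiff_quadPoly p H).contDiffAt) (hX.to_localInverse hd (by simp))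
  · have := (hX.hasStrictFDerivAt' hd (by simp)).eventually_left_inverse
    exact this.mono fun y hy => congrArg (T.newU (quadPoly p H)) hy

end EquivalenceGroup

/-! ### Linearizability and the normal form -/

theorem one_add_vecMulVec_mul {n : ℕ} (a r : Fin n → ℝ) :
    (1 + Matrix.vecMulVec a r) * (slideMatrix a r)ᵀ = (1 + a ⬝ᵥ r) • 1 := by
  simp only [slideMatrix, Matrix.transpose_sub, Matrix.transpose_smul, Matrix.transpose_one,
    Matrix.transpose_vecMulVec, Matrix.mul_sub, Matrix.add_mul, Matrix.one_mul,
    Matrix.vecMulVec_mul_vecMulVec, Matrix.mul_smul, Matrix.mul_one, dotProduct_comm r a]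
  simp only [add_smul, one_smul, smul_add, Matrix.vecMulVec_smul]
  abel

theorem QuasilinearEquation.linearizable_iff {n : ℕ} [NeZero n] (E : QuasilinearEquation n) :
    E.Linearizable ↔ E.HasProjectiveNormalForm := by
  constructor
  · rintro ⟨T, A, hA, -, hreg, h⟩
    have key : ∀ p ∈ E.domain, ∃ c : ℝ, c ≠ 0 ∧
        (T.jacobian p)⁻¹ * A * ((T.jacobian p)⁻¹)ᵀ = c • E.coeff p := by
      intro p hp
      refine exists_eq_smul_of_annihilator ?_ (E.symm_coeff p hp) (E.coeff_ne_zero hp)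
        fun H hH => ?_
      · simpa using hA.conj ((T.jacobian p)⁻¹)ᵀ
      · obtain ⟨u', hu', hm⟩ := T.exists_mapsGraph (hreg p hp) hH
        have hp' : grad (quadPoly p H) 0 = p := by simp [grad_quadPoly p hH]
        have hu : ContDiffAt ℝ 2 (quadPoly p H) 0 := (contDiff_quadPoly p H).contDiffAt
        have h1 := h _ u' 0 hu hu' (by rwa [hp']) hm
        rw [T.satisfiesAt_iff hu hu' hm (by rw [hp']; exact hreg p hp), HoldsAt, hp', SatisfiesAt,
          SatisfiesAt, hess_quadPoly p hH] at h1
        exact h1.symm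
    obtain ⟨p₀, hp₀⟩ := E.nonempty_domain
    set b : Fin n → ℝ := fun i => T.1 (Sum.inl i) (Sum.inr ()) with hb
    set J₀ := T.jacobian p₀ with hJ₀
    have hu0 : IsUnit J₀.det := isUnit_iff_ne_zero.2 (hreg p₀ hp₀)
    -- J(p) - J(p₀) = b (p - p₀)ᵀ has rank at most one; factoring out J(p₀) leaves 1 + a rᵀ, whose
    -- inverse is a multiple of the transposed slide matrix.
    set a := J₀⁻¹ *ᵥ b with ha
    have hJ : ∀ p, T.jacobian p = J₀ * (1 + Matrix.vecMulVec a (p - p₀)) := by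
      intro p
      rw [Matrix.mul_add, Matrix.mul_vecMulVec, ha, Matrix.mulVec_mulVec,
        Matrix.mul_nonsing_inv _ hu0, Matrix.one_mulVec, Matrix.mul_one]
      ext i j
      simp [hJ₀, EquivalenceGroup.jacobian, Matrix.vecMulVec_apply, hb]
      ring
    obtain ⟨c₀, hc₀, h0⟩ := key p₀ hp₀
    refine ⟨p₀, hp₀, a, fun p hp => ?_⟩
    -- The factor 1 + a rᵀ multiplies a by 1 + a·r, so a zero here would put a in the kernel of
    -- J(p).
    have hl : 1 + a ⬝ᵥ (p - p₀) ≠ 0 := by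
      intro hl
      have h1 : T.jacobian p *ᵥ a = 0 := by
        rw [hJ, ← Matrix.mulVec_mulVec, Matrix.add_mulVec, Matrix.one_mulVec,
          Matrix.vecMulVec_mulVec, op_smul_eq_smul, dotProduct_comm]
        have : a + (a ⬝ᵥ (p - p₀)) • a = (1 + a ⬝ᵥ (p - p₀)) • a := by rw [add_smul, one_smul]
        rw [this, hl, zero_smul, Matrix.mulVec_zero]
      have h2 := Matrix.eq_zero_of_mulVec_eq_zero (hreg p hp) h1
      rw [h2] at hl
      simp at hl
    refine ⟨hl, ?_⟩
    obtain ⟨c, hc, h1⟩ := key p hp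
    set s := 1 + a ⬝ᵥ (p - p₀)
    have hinv : (T.jacobian p)⁻¹ = s⁻¹ • ((slideMatrix a (p - p₀))ᵀ * J₀⁻¹) := by
      apply Matrix.inv_eq_right_inv
      rw [hJ, Matrix.mul_smul, Matrix.mul_assoc, ← Matrix.mul_assoc _ (slideMatrix _ _)ᵀ,
        one_add_vecMulVec_mul, Matrix.smul_mul, Matrix.one_mul, Matrix.mul_smul, smul_smul,
        inv_mul_cancel₀ hl, one_smul, Matrix.mul_nonsing_inv _ hu0]
    refine ⟨c⁻¹ * (s⁻¹ * s⁻¹) * c₀, by positivity, ?_⟩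
    have h2 : E.coeff p = c⁻¹ • (c • E.coeff p) := by
      rw [smul_smul, inv_mul_cancel₀ hc, one_smul]
    have h3 : c₀ • ((slideMatrix a (p - p₀))ᵀ * E.coeff p₀ * slideMatrix a (p - p₀)) =
        (slideMatrix a (p - p₀))ᵀ * (J₀⁻¹ * A * (J₀⁻¹)ᵀ) * slideMatrix a (p - p₀) := by
      rw [h0]; simp
    rw [h2, ← h1, hinv, mul_smul, h3]
    simp only [Matrix.transpose_smul, Matrix.transpose_mul, Matrix.transpose_transpose,
      Matrix.smul_mul, Matrix.mul_smul, smul_smul, Matrix.mul_assoc]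
  · rintro ⟨p₀, hp₀, a, h⟩
    -- The transformation is ũ = u - p₀·x followed by x̃ = x + a ũ, a product of two shears. Its
    -- Jacobian 1 + a (p - p₀)ᵀ is the identity at p₀, so the linear equation has coefficients
    -- f(p₀).
    set M : Matrix (Fin n ⊕ Unit) (Fin n ⊕ Unit) ℝ :=
      Matrix.fromBlocks 1 (Matrix.replicateCol Unit a) 0 1 *
        Matrix.fromBlocks 1 0 (Matrix.replicateRow Unit (-p₀)) 1 with hM
    have hdet : M.det = 1 := by
      rw [hM, Matrix.det_mul, Matrix.det_fromBlocks_zero₂₁, Matrix.det_fromBlocks_zero₁₂]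
      simp
    set T : EquivalenceGroup n := ⟨M, hdet⟩ with hT
    have hJ : ∀ p, T.jacobian p = 1 + Matrix.vecMulVec a (p - p₀) := by
      intro p
      ext i j
      simp [EquivalenceGroup.jacobian, hT, hM, Matrix.fromBlocks_multiply, Matrix.mul_apply,
        Matrix.vecMulVec_apply]
      ring
    have hinv : ∀ p ∈ E.domain, (T.jacobian p)⁻¹ =
        (1 + a ⬝ᵥ (p - p₀))⁻¹ • (slideMatrix a (p - p₀))ᵀ ∧ (T.jacobian p).det ≠ 0 := by
      intro p hp
      have hr : T.jacobian p * ((1 + a ⬝ᵥ (p - p₀))⁻¹ • (slideMatrix a (p - p₀))ᵀ) = 1 := by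
        rw [hJ, Matrix.mul_smul, one_add_vecMulVec_mul, smul_smul, inv_mul_cancel₀ (h p hp).1,
          one_smul]
      exact ⟨Matrix.inv_eq_right_inv hr, (Matrix.isUnit_det_of_right_inverse hr).ne_zero⟩
    refine ⟨T, E.coeff p₀, E.symm_coeff p₀ hp₀, E.nondegenerate_coeff p₀ hp₀,
      fun p hp => (hinv p hp).2, fun u u' x hu hu' hx hm => ?_⟩
    rw [T.satisfiesAt_iff hu hu' hm (hinv _ hx).2, (hinv _ hx).1, HoldsAt]
    obtain ⟨hl, c, hc, h1⟩ := h _ hx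
    rw [h1, SatisfiesAt, SatisfiesAt]
    generalize 1 + a ⬝ᵥ (grad u x - p₀) = s at hl
    simp only [Matrix.transpose_smul, Matrix.transpose_transpose, Matrix.smul_mul, Matrix.mul_smul,
      Matrix.smul_apply, smul_eq_mul, mul_assoc, ← Finset.mul_sum]
    simp [hc, hl]

/-! ### Lines through a point -/

theorem isProjLine_span {n : ℕ} {a b : Fin (n + 1) → ℂ} (h : LinearIndependent ℂ ![a, b]) :
    IsProjLine (Submodule.span ℂ {a, b}) := by
  have := finrank_span_eq_card h
  have hr : Set.range ![a, b] = {a, b} := by simp [Matrix.range_cons, Set.pair_comm]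
  rw [hr] at this
  exact this

theorem IsProjLine.eq_span {n : ℕ} {L : Submodule ℂ (Fin (n + 1) → ℂ)} (hL : IsProjLine L)
    {a b : Fin (n + 1) → ℂ} (ha : a ∈ L) (hb : b ∈ L) (h : LinearIndependent ℂ ![a, b]) :
    L = Submodule.span ℂ {a, b} := by
  refine (Submodule.eq_of_le_of_finrank_eq ?_ ?_).symm
  · rw [Submodule.span_le]
    rintro x (rfl | rfl)
    exacts [ha, hb]
  · exact (isProjLine_span h).trans hL.symm

theorem linearIndependent_homog {n : ℕ} (p : Fin n → ℝ) {v : Fin n → ℂ} (hv : v ≠ 0) :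
    LinearIndependent ℂ ![homog p, (Fin.cons 0 v : Fin (n + 1) → ℂ)] := by
  rw [LinearIndependent.pair_iff]
  intro s t hst
  have hs : s = 0 := by simpa [homog] using congrFun hst 0
  refine ⟨hs, ?_⟩
  obtain ⟨i, hi⟩ := Function.ne_iff.1 hv
  have := congrFun hst i.succ
  simpa [hs, show v i ≠ 0 from hi] using this

theorem cons_zero_eq_sub {n : ℕ} (p : Fin n → ℝ) (w : Fin (n + 1) → ℂ) :
    (Fin.cons 0 fun i => w i.succ - w 0 * p i : Fin (n + 1) → ℂ) = w - w 0 • homog p := by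
  ext s
  refine Fin.cases ?_ (fun i => ?_) s <;> simp [homog]

/-- The line through the point `p` with direction `v`. -/
def lineThrough {n : ℕ} (p : Fin n → ℝ) (v : Fin n → ℂ) : Submodule ℂ (Fin (n + 1) → ℂ) :=
  Submodule.span ℂ {homog p, Fin.cons 0 v}

theorem isProjLine_lineThrough {n : ℕ} (p : Fin n → ℝ) {v : Fin n → ℂ} (hv : v ≠ 0) :
    IsProjLine (lineThrough p v) :=
  isProjLine_span (linearIndependent_homog p hv)

theorem homog_mem_lineThrough {n : ℕ} (p : Fin n → ℝ) (v : Fin n → ℂ) :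
    homog p ∈ lineThrough p v :=
  Submodule.subset_span (by simp)

theorem cons_mem_lineThrough {n : ℕ} (p : Fin n → ℝ) (v : Fin n → ℂ) :
    (Fin.cons 0 v : Fin (n + 1) → ℂ) ∈ lineThrough p v :=
  Submodule.subset_span (by simp)

theorem IsProjLine.exists_eq_lineThrough {n : ℕ} {L : Submodule ℂ (Fin (n + 1) → ℂ)}
    (hL : IsProjLine L) {p : Fin n → ℝ} (hp : homog p ∈ L) :
    ∃ v : Fin n → ℂ, v ≠ 0 ∧ L = lineThrough p v := by
  obtain ⟨w, hw, hne⟩ : ∃ w ∈ L, w ≠ w 0 • homog p := by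
    by_contra! hcon
    have h1 : L ≤ Submodule.span ℂ {homog p} := fun w hw =>
      Submodule.mem_span_singleton.2 ⟨w 0, (hcon w hw).symm⟩
    have h2 := (Submodule.finrank_mono h1).trans (finrank_span_le_card {homog p})
    rw [show Module.finrank ℂ L = 2 from hL] at h2
    simp at h2
  have hc := cons_zero_eq_sub p w
  have hv : (fun i => w (Fin.succ i) - w 0 * p i) ≠ 0 := by
    intro h0
    rw [h0] at hc
    apply hne
    rw [← sub_eq_zero, ← hc]
    ext s
    refine Fin.cases ?_ (fun i => ?_) s <;> simp
  refine ⟨_, hv, hL.eq_span hp ?_ (linearIndependent_homog p hv)⟩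
  rw [hc]
  exact L.sub_mem hw (L.smul_mem _ hp)

theorem QuasilinearEquation.isNullAt_lineThrough_iff {n : ℕ} (E : QuasilinearEquation n)
    (p : Fin n → ℝ) (v : Fin n → ℂ) :
    E.IsNullAt (lineThrough p v) p ↔ complexQuad (E.coeff p) v = 0 := by
  constructor
  · intro h
    exact h v (cons_mem_lineThrough p v)
  · intro h v' hv'
    obtain ⟨s, t, hst⟩ := Submodule.mem_span_pair.1 hv'
    have hs : s = 0 := by simpa [homog] using congrFun hst 0
    have : v' = t • v := by
      ext i
      simpa [hs] using (congrFun hst i.succ).symm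
    have h2 := complexQuad_smul (E.coeff p) t v
    rw [h, mul_zero, ← this] at h2
    exact h2

theorem QuasilinearEquation.isFamilyOfNullLines_iff {n : ℕ} (E : QuasilinearEquation n)
    (K : Set (Submodule ℂ (Fin (n + 1) → ℂ))) : E.IsFamilyOfNullLines K ↔
      ∀ p ∈ E.domain, ∀ v : Fin n → ℂ, v ≠ 0 →
        (lineThrough p v ∈ K ↔ complexQuad (E.coeff p) v = 0) := by
  constructor
  · intro h p hp v hv
    rw [h p hp _ (isProjLine_lineThrough p hv) (homog_mem_lineThrough p v),
      E.isNullAt_lineThrough_iff]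
  · intro h p hp L hL hpL
    obtain ⟨v, hv, rfl⟩ := hL.exists_eq_lineThrough hpL
    rw [h p hp v hv, E.isNullAt_lineThrough_iff]

/-- A homogeneous quadratic relation between the Plücker coordinates holds on a line if it holds
for one pair of points that span it. -/
theorem forall_mem_span_plucker_iff {n : ℕ} {f : (Fin (n + 1) × Fin (n + 1) → ℂ) → ℂ}
    (hf : ∀ (c : ℂ) x, f (c • x) = c ^ 2 * f x) (a b : Fin (n + 1) → ℂ) :
    (∀ x ∈ Submodule.span ℂ {a, b}, ∀ y ∈ Submodule.span ℂ {a, b}, f (plucker x y) = 0) ↔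
      f (plucker a b) = 0 := by
  constructor
  · intro h
    exact h a (Submodule.subset_span (by simp)) b (Submodule.subset_span (by simp))
  · intro h x hx y hy
    obtain ⟨s, t, rfl⟩ := Submodule.mem_span_pair.1 hx
    obtain ⟨s', t', rfl⟩ := Submodule.mem_span_pair.1 hy
    have : plucker (s • a + t • b) (s' • a + t' • b) = (s * t' - t * s') • plucker a b := by
      ext z
      simp [plucker]
      ring
    rw [this, hf, h, mul_zero]

/-! ### The complex of lines that meet a quadric in a hyperplane -/

/-- The quadratic equation, in Plücker coordinates, of the lines that meet the quadric
`wᵀ S w = 0` in the hyperplane `h · w = 0`. -/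
noncomputable def meetPolynomial {n : ℕ} (h : Fin (n + 1) → ℝ)
    (S : Matrix (Fin (n + 1)) (Fin (n + 1)) ℝ) :
    MvPolynomial (Fin (n + 1) × Fin (n + 1)) ℝ :=
  ∑ i, ∑ j, MvPolynomial.C (S i j) * (∑ k, MvPolynomial.C (h k) * MvPolynomial.X (i, k)) *
    (∑ k, MvPolynomial.C (h k) * MvPolynomial.X (j, k))

theorem isHomogeneous_meetPolynomial {n : ℕ} (h : Fin (n + 1) → ℝ)
    (S : Matrix (Fin (n + 1)) (Fin (n + 1)) ℝ) : (meetPolynomial h S).IsHomogeneous 2 := by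
  have h1 : ∀ i : Fin (n + 1), (∑ k, MvPolynomial.C (h k) * MvPolynomial.X (i, k) :
      MvPolynomial (Fin (n + 1) × Fin (n + 1)) ℝ).IsHomogeneous 1 := fun i =>
    MvPolynomial.IsHomogeneous.sum _ _ _ fun k _ => by
      simpa using (MvPolynomial.isHomogeneous_C _ (h k)).mul (MvPolynomial.isHomogeneous_X ℝ (i, k))
  refine MvPolynomial.IsHomogeneous.sum _ _ _ fun i _ =>
    MvPolynomial.IsHomogeneous.sum _ _ _ fun j _ => ?_
  simpa using ((MvPolynomial.isHomogeneous_C _ (S i j)).mul (h1 i)).mul (h1 j)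

theorem aeval_meetPolynomial {n : ℕ} (h : Fin (n + 1) → ℝ)
    (S : Matrix (Fin (n + 1)) (Fin (n + 1)) ℝ) (x : Fin (n + 1) × Fin (n + 1) → ℂ) :
    MvPolynomial.aeval x (meetPolynomial h S) =
      complexQuad S (fun i => ∑ k, (h k : ℂ) * x (i, k)) := by
  simp [meetPolynomial, complexQuad]

/-- Contracting the Plücker coordinates with h yields the point where the line meets the hyperplane,
or zero if the line lies in it. This is why one quadratic equation describes the lines meeting the
quadric. -/
theorem sum_mul_plucker {n : ℕ} (h : Fin (n + 1) → ℝ) (a b : Fin (n + 1) → ℂ) :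
    (fun i => ∑ k, (h k : ℂ) * plucker a b (i, k)) =
      (∑ k, (h k : ℂ) * b k) • a - (∑ k, (h k : ℂ) * a k) • b := by
  ext i
  simp only [plucker, Pi.sub_apply, Pi.smul_apply, smul_eq_mul, Finset.sum_mul,
    ← Finset.sum_sub_distrib]
  exact Finset.sum_congr rfl fun k _ => by ring

/-- The complex of the lines that meet a given quadric in a hyperplane. -/
def meetComplex {n : ℕ} (h : Fin (n + 1) → ℝ) (S : Matrix (Fin (n + 1)) (Fin (n + 1)) ℝ) :
    Set (Submodule ℂ (Fin (n + 1) → ℂ)) :=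
  {L | IsProjLine L ∧ ∀ a ∈ L, ∀ b ∈ L,
    MvPolynomial.aeval (plucker a b) (meetPolynomial h S) = 0}

theorem span_mem_meetComplex_iff {n : ℕ} (h : Fin (n + 1) → ℝ)
    (S : Matrix (Fin (n + 1)) (Fin (n + 1)) ℝ) {a b : Fin (n + 1) → ℂ}
    (hab : LinearIndependent ℂ ![a, b]) : Submodule.span ℂ {a, b} ∈ meetComplex h S ↔
      complexQuad S ((∑ k, (h k : ℂ) * b k) • a - (∑ k, (h k : ℂ) * a k) • b) = 0 := by
  rw [meetComplex, Set.mem_ofPred_eq, and_iff_right (isProjLine_span hab),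
    forall_mem_span_plucker_iff (f := fun x => MvPolynomial.aeval x (meetPolynomial h S)),
    aeval_meetPolynomial, sum_mul_plucker]
  intro c x
  simp only [aeval_meetPolynomial]
  rw [← complexQuad_smul]
  congr 1
  ext i
  simp only [Pi.smul_apply, smul_eq_mul, Finset.mul_sum]
  exact Finset.sum_congr rfl fun k _ => by ring

theorem complexQuad_eq_dotProduct {m : Type*} [Fintype m] (A : Matrix m m ℝ) (w : m → ℂ) :
    complexQuad A w = w ⬝ᵥ (A.map Complex.ofReal) *ᵥ w := by
  rw [dotProduct_mulVec_eq_sum]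
  rfl

theorem complexQuad_conj {m k : Type*} [Fintype m] [Fintype k] (S : Matrix m m ℝ)
    (R : Matrix m k ℝ) (v : k → ℂ) :
    complexQuad (Rᵀ * S * R) v = complexQuad S (fun s => ∑ j, (R s j : ℂ) * v j) := by
  have h2 : (Rᵀ * S * R).map Complex.ofReal =
      (R.map Complex.ofReal)ᵀ * S.map Complex.ofReal * R.map Complex.ofReal := by
    ext i j
    simp [Matrix.mul_apply]
  rw [complexQuad_eq_dotProduct, complexQuad_eq_dotProduct, h2, ← Matrix.mulVec_mulVec,
    ← Matrix.mulVec_mulVec, Matrix.dotProduct_mulVec, Matrix.vecMul_transpose]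
  rfl

theorem sum_homog {n : ℕ} (h : Fin (n + 1) → ℝ) (p : Fin n → ℝ) :
    ∑ k, (h k : ℂ) * homog p k = (affineForm h p : ℂ) := by
  simp [affineForm, dotProduct, Fin.sum_univ_succ, homog]

theorem sum_meetMatrix_mul {n : ℕ} (h : Fin (n + 1) → ℝ) (p : Fin n → ℝ) (v : Fin n → ℂ) :
    (fun s => ∑ j, (meetMatrix h p s j : ℂ) * v j) =
      (affineForm h p : ℂ) • (Fin.cons 0 v : Fin (n + 1) → ℂ) -
        (∑ j, (h j.succ : ℂ) * v j) • homog p := by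
  ext s
  refine Fin.cases ?_ (fun i => ?_) s
  · simp [meetMatrix, homog]
  · simp [meetMatrix, homog, sub_mul, Finset.sum_sub_distrib, Finset.sum_mul, Pi.single_apply,
      mul_right_comm, apply_ite Complex.ofReal]

theorem lineThrough_mem_meetComplex_iff {n : ℕ} (h : Fin (n + 1) → ℝ)
    (S : Matrix (Fin (n + 1)) (Fin (n + 1)) ℝ) (p : Fin n → ℝ) {v : Fin n → ℂ} (hv : v ≠ 0) :
    lineThrough p v ∈ meetComplex h S ↔
      complexQuad ((meetMatrix h p)ᵀ * S * meetMatrix h p) v = 0 := by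
  rw [lineThrough, span_mem_meetComplex_iff h S (linearIndependent_homog p hv), complexQuad_conj,
    sum_meetMatrix_mul, sum_homog]
  have h1 : ∑ k, (h k : ℂ) * (Fin.cons 0 v : Fin (n + 1) → ℂ) k = ∑ j, (h j.succ : ℂ) * v j := by
    simp [Fin.sum_univ_succ]
  rw [h1, ← neg_sub, ← neg_one_smul ℂ, complexQuad_smul]
  simp

theorem dotProduct_meetMatrix_mulVec {n : ℕ} (h : Fin (n + 1) → ℝ) (p v : Fin n → ℝ) :
    h ⬝ᵥ meetMatrix h p *ᵥ v = 0 := by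
  rw [meetMatrix_mulVec, affineForm_eq]
  simp only [dotProduct, Fin.sum_univ_succ, Fin.cons_zero, Fin.cons_succ, Pi.sub_apply,
    Pi.smul_apply, smul_eq_mul, mul_sub, Finset.sum_sub_distrib]
  have h1 : ∀ c : ℝ, ∀ w : Fin n → ℝ, ∑ i, h (Fin.succ i) * (c * w i) =
    c * ∑ i, h (Fin.succ i) * w i := fun c w => by
      rw [Finset.mul_sum]; exact Finset.sum_congr rfl fun i _ => by ring
  rw [h1, h1]
  ring

theorem meetMatrix_mulVec_dirMatrix_mulVec {n : ℕ} {h w : Fin (n + 1) → ℝ} (p : Fin n → ℝ)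
    (hw : h ⬝ᵥ w = 0) : meetMatrix h p *ᵥ (dirMatrix p *ᵥ w) = affineForm h p • w := by
  rw [dirMatrix_mulVec, meetMatrix_mulVec]
  have h1 : (fun i => h (Fin.succ i)) ⬝ᵥ (fun i => w (Fin.succ i)) = -(h 0 * w 0) := by
    rw [dotProduct, Fin.sum_univ_succ] at hw
    rw [dotProduct]; linarith
  rw [dotProduct_sub, dotProduct_smul, h1, affineForm_eq]
  ext s
  refine Fin.cases ?_ (fun i => ?_) s <;> simp <;> ring

theorem dirMatrix_mul_meetMatrix {n : ℕ} (h : Fin (n + 1) → ℝ) (p v : Fin n → ℝ) :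
    dirMatrix p *ᵥ (meetMatrix h p *ᵥ v) = affineForm h p • v := by
  rw [dirMatrix_mulVec, meetMatrix_mulVec]
  ext i
  simp

/-- The complex is `meetComplex h S`. For p off the hyperplane, `meetMatrix` and `dirMatrix` are
inverse, up to the factor h(1, p), between directions at p and vectors of the hyperplane, so
non-degeneracy of f(p₀) passes to S. -/
theorem QuasilinearEquation.hasNullComplex_of_meetMatrix {n : ℕ} [NeZero n]
    (E : QuasilinearEquation n) {h : Fin (n + 1) → ℝ} {S : Matrix (Fin (n + 1)) (Fin (n + 1)) ℝ}
    (hS : S.IsSymm) (hE : ∀ p ∈ E.domain, affineForm h p ≠ 0 ∧ ∃ c : ℝ, c ≠ 0 ∧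
      E.coeff p = c • ((meetMatrix h p)ᵀ * S * meetMatrix h p)) :
    E.HasNullComplexThroughHyperplaneQuadric := by
  obtain ⟨p₀, hp₀⟩ := E.nonempty_domain
  obtain ⟨hl₀, c₀, hc₀, h0⟩ := hE p₀ hp₀
  have hfam : E.IsFamilyOfNullLines (meetComplex h S) := by
    rw [E.isFamilyOfNullLines_iff]
    intro p hp v hv
    obtain ⟨-, c, hc, h1⟩ := hE p hp
    rw [lineThrough_mem_meetComplex_iff h S p hv, h1, complexQuad_smul_matrix]
    simp [hc]
  refine ⟨meetComplex h S, ⟨2, meetPolynomial h S, two_pos, isHomogeneous_meetPolynomial h S, rfl,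
    ?_⟩, hfam, h, S, ?_, hS, ?_, ?_⟩
  · obtain ⟨x, hx⟩ : ∃ x, x ⬝ᵥ E.coeff p₀ *ᵥ x ≠ 0 := by
      by_contra! hcon
      refine E.coeff_ne_zero hp₀ (Matrix.IsSymm.ext_quad (E.symm_coeff p₀ hp₀)
        Matrix.isSymm_zero fun x => ?_)
      rw [hcon]; simp
    have hx0 : (fun i => (x i : ℂ)) ≠ 0 := by
      intro h0
      apply hx
      have : x = 0 := funext fun i => by simpa using congrFun h0 i
      simp [this]
    refine ⟨lineThrough p₀ fun i => (x i : ℂ), isProjLine_lineThrough p₀ hx0, ?_⟩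
    rw [(E.isFamilyOfNullLines_iff _).1 hfam p₀ hp₀ _ hx0, complexQuad_ofReal]
    exact_mod_cast hx
  · rintro rfl
    apply hl₀
    simp [affineForm]
  · intro w hw hw'
    have hR := meetMatrix_mulVec_dirMatrix_mulVec p₀ hw
    have hx : dirMatrix p₀ *ᵥ w = 0 := by
      refine Matrix.eq_zero_of_dotProduct_mulVec (E.symm_coeff p₀ hp₀)
        (E.nondegenerate_coeff p₀ hp₀) fun y => ?_
      rw [h0, Matrix.smul_mulVec, dotProduct_smul, quad_conj, hR, smul_dotProduct,
        hw' _ (dotProduct_meetMatrix_mulVec h p₀ y)]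
      simp
    rw [hx, Matrix.mulVec_zero] at hR
    exact (smul_eq_zero.1 hR.symm).resolve_left hl₀
  · rintro p hp w ⟨hw0, hw, hwS⟩
    obtain ⟨hl, -⟩ := hE p hp
    have hli : LinearIndependent ℂ ![homog p, w] := by
      rw [LinearIndependent.pair_iff]
      intro s t hst
      have h1 : ∑ k, (h k : ℂ) * (s • homog p + t • w) k = s * affineForm h p := by
        simp only [Pi.add_apply, Pi.smul_apply, smul_eq_mul, mul_add, Finset.sum_add_distrib,
          mul_left_comm _ s, mul_left_comm _ t, ← Finset.mul_sum, hw, sum_homog]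
        ring
      have hs : s = 0 := by
        rw [hst] at h1
        simpa [hl] using h1.symm
      refine ⟨hs, ?_⟩
      rw [hs, zero_smul, zero_add] at hst
      exact (smul_eq_zero.1 hst).resolve_right hw0
    refine ⟨_, (span_mem_meetComplex_iff h S hli).2 ?_, Submodule.subset_span (by simp),
      Submodule.subset_span (by simp)⟩
    rw [hw, zero_smul, zero_sub, ← neg_smul, complexQuad_smul]
    exact mul_eq_zero_of_right _ hwS

/-! ### From the quadric to the projective normal form -/

/-- On the hyperplane, the form of `E` at `p` is a multiple of the form that defines a
non-singular quadric through which the null cone at `p` passes. -/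
theorem QuasilinearEquation.exists_eq_mul_of_quadric_subset {n : ℕ} (E : QuasilinearEquation n)
    {K : Set (Submodule ℂ (Fin (n + 1) → ℂ))} (hK : ∀ L ∈ K, IsProjLine L)
    (hfam : E.IsFamilyOfNullLines K) {h : Fin (n + 1) → ℝ}
    {S : Matrix (Fin (n + 1)) (Fin (n + 1)) ℝ} (hS : S.IsSymm) (hns : NonsingularOn h S)
    {p : Fin n → ℝ} (hp : p ∈ E.domain) (hsub : hyperplaneQuadric h S ⊆ coneAt K p) :
    ∃ c : ℝ, ∀ x y, h ⬝ᵥ x = 0 → h ⬝ᵥ y = 0 →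
      (dirMatrix p *ᵥ x) ⬝ᵥ E.coeff p *ᵥ (dirMatrix p *ᵥ y) = c * (x ⬝ᵥ S *ᵥ y) := by
  set A := (dirMatrix p)ᵀ * E.coeff p * dirMatrix p with hA
  have hAs : A.IsSymm := (E.symm_coeff p hp).conj _
  let V : Submodule ℝ (Fin (n + 1) → ℝ) :=
    { carrier := {w | h ⬝ᵥ w = 0}
      add_mem' := fun {a b} ha hb => by
        simp only [Set.mem_ofPred_eq, dotProduct_add] at *; rw [ha, hb, add_zero]
      zero_mem' := by simp
      smul_mem' := fun c x hx => by
        simp only [Set.mem_ofPred_eq, dotProduct_smul] at *; rw [hx, smul_zero] }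
  have happ : ∀ (M : Matrix (Fin (n + 1)) (Fin (n + 1)) ℝ) (x y : V),
      (Matrix.toBilin' M).restrict V x y = x.1 ⬝ᵥ M *ᵥ y.1 := fun M x y => by
    rw [LinearMap.BilinForm.restrict_apply, LinearMap.domRestrict_apply, Matrix.toBilin'_apply']
  -- A complex null vector of S in the hyperplane lies on the cone at p, so its projection along p
  -- is a null direction of f(p). The argument allows p to lie on the hyperplane.
  obtain ⟨c, hc⟩ := LinearMap.BilinForm.exists_eq_smul_of_null ((Matrix.toBilin' S).restrict V)
    ((Matrix.toBilin' A).restrict V)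
    (fun x y => by rw [happ, happ]; exact dotProduct_mulVec_comm hS _ _)
    (fun x y => by rw [happ, happ]; exact dotProduct_mulVec_comm hAs _ _)
    (fun x hx => Subtype.ext (hns x.1 x.2 fun w' hw' => by
      have := hx ⟨w', hw'⟩
      rwa [happ] at this))
    (fun x y hxy hxy' => by
      simp only [happ] at *
      have h1 := (complexQuad_add_I_mul_eq_zero hS x.1 y.1).2 ⟨hxy, hxy'⟩
      rw [← complexQuad_add_I_mul_eq_zero hAs x.1 y.1]
      set w : Fin (n + 1) → ℂ := fun i => (x.1 i : ℂ) + Complex.I * y.1 i with hw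
      by_cases hw0 : w = 0
      · rw [hw0]; simp [complexQuad]
      obtain ⟨L, hLK, hpL, hwL⟩ := hsub (show w ∈ hyperplaneQuadric h S from ⟨hw0, by
        have hx2 : ∑ i, (h i : ℂ) * x.1 i = 0 := by exact_mod_cast x.2
        have hy2 : ∑ i, (h i : ℂ) * y.1 i = 0 := by exact_mod_cast y.2
        simp only [hw, mul_add, Finset.sum_add_distrib, mul_left_comm _ Complex.I,
          ← Finset.mul_sum, hx2, hy2]
        simp, h1⟩)
      have h2 := (hfam p hp L (hK L hLK) hpL).1 hLK (fun i => w i.succ - w 0 * p i) (by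
        rw [cons_zero_eq_sub]
        exact L.sub_mem hwL (L.smul_mem _ hpL))
      rw [hA, complexQuad_conj]
      have h3 : (fun s => ∑ j, (dirMatrix p s j : ℂ) * w j) = fun i => w i.succ - w 0 * p i := by
        ext i
        simp [dirMatrix, Fin.sum_univ_succ, Pi.single_apply, apply_ite Complex.ofReal]
        ring
      rw [h3]
      exact h2)
  refine ⟨c, fun x y hx hy => ?_⟩
  have := hc ⟨x, hx⟩ ⟨y, hy⟩
  rwa [happ, happ, hA, quad_conj] at this

/-- Off the hyperplane every direction v at p comes from a point of the hyperplane: projecting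
`meetMatrix h p *ᵥ v` along p returns h(1, p) v, whence the square in the factor. -/
theorem QuasilinearEquation.coeff_eq_of_quadric {n : ℕ} (E : QuasilinearEquation n)
    {h : Fin (n + 1) → ℝ} {S : Matrix (Fin (n + 1)) (Fin (n + 1)) ℝ}
    (hS : S.IsSymm) {p : Fin n → ℝ} (hp : p ∈ E.domain) (hl : affineForm h p ≠ 0) {c : ℝ}
    (hc : ∀ x y, h ⬝ᵥ x = 0 → h ⬝ᵥ y = 0 →
      (dirMatrix p *ᵥ x) ⬝ᵥ E.coeff p *ᵥ (dirMatrix p *ᵥ y) = c * (x ⬝ᵥ S *ᵥ y)) :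
    E.coeff p = (c / affineForm h p ^ 2) • ((meetMatrix h p)ᵀ * S * meetMatrix h p) := by
  refine Matrix.IsSymm.ext_quad (E.symm_coeff p hp) ((hS.conj _).smul _) fun v => ?_
  have h1 := hc _ _ (dotProduct_meetMatrix_mulVec h p v) (dotProduct_meetMatrix_mulVec h p v)
  rw [dirMatrix_mul_meetMatrix, Matrix.mulVec_smul, dotProduct_smul, smul_dotProduct, smul_eq_mul,
    smul_eq_mul] at h1
  rw [Matrix.smul_mulVec, dotProduct_smul, quad_conj, smul_eq_mul]
  field_simp
  linarith

/-- The domain does not meet the hyperplane. -/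
theorem QuasilinearEquation.affineForm_ne_zero_of_quadric {n : ℕ} (hn : 2 ≤ n)
    (E : QuasilinearEquation n) {h : Fin (n + 1) → ℝ} (hh : h ≠ 0)
    {S : Matrix (Fin (n + 1)) (Fin (n + 1)) ℝ} (hS : S.IsSymm) (hns : NonsingularOn h S)
    (hE : ∀ p ∈ E.domain, ∃ c : ℝ, ∀ x y, h ⬝ᵥ x = 0 → h ⬝ᵥ y = 0 →
      (dirMatrix p *ᵥ x) ⬝ᵥ E.coeff p *ᵥ (dirMatrix p *ᵥ y) = c * (x ⬝ᵥ S *ᵥ y))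
    {p : Fin n → ℝ} (hp : p ∈ E.domain) : affineForm h p ≠ 0 := by
  -- Suppose p lies on the hyperplane. Continuity from outside forces S(P, P) = 0 at every point P =
  -- (1, q) of the domain in the hyperplane, as otherwise f(q) would have rank at most one.
  -- Differentiating along the hyperplane then puts (1, p) in the radical of S there.
  intro hl
  set e : Fin n → ℝ := fun i => h (Fin.succ i) with he
  have he0 : e ⬝ᵥ e ≠ 0 := by
    intro h0
    have h1 : e = 0 := dotProduct_self_eq_zero.1 h0
    rw [affineForm_eq, ← he, h1, zero_dotProduct, add_zero] at hl
    apply hh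
    ext s
    refine Fin.cases hl (fun i => congrFun h1 i) s
  have hline : ∀ (q u : Fin n → ℝ), q ∈ E.domain → ∀ᶠ t : ℝ in 𝓝 0, q + t • u ∈ E.domain := by
    intro q u hq
    have hcont : Continuous fun t : ℝ => q + t • u := by fun_prop
    exact hcont.continuousAt.eventually (E.isOpen_domain.mem_nhds (by simpa using hq))
  have haff : ∀ (q u : Fin n → ℝ) (t : ℝ), affineForm h (q + t • u) =
      affineForm h q + t * (e ⬝ᵥ u) := by
    intro q u t
    rw [affineForm_eq, affineForm_eq, ← he, dotProduct_add, dotProduct_smul, smul_eq_mul, add_assoc]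
  have hSP : ∀ q ∈ E.domain, affineForm h q = 0 →
      (Fin.cons 1 q : Fin (n + 1) → ℝ) ⬝ᵥ S *ᵥ (Fin.cons 1 q : Fin (n + 1) → ℝ) = 0 := by
    intro q hq hlq
    set P : Fin (n + 1) → ℝ := Fin.cons 1 q with hP
    by_contra hne
    have hid : ∀ v v' : Fin n → ℝ, (v ⬝ᵥ E.coeff q *ᵥ v) * ((e ⬝ᵥ v') ^ 2 * (P ⬝ᵥ S *ᵥ P)) =
        (v' ⬝ᵥ E.coeff q *ᵥ v') * ((e ⬝ᵥ v) ^ 2 * (P ⬝ᵥ S *ᵥ P)) := by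
      intro v v'
      set m : (Fin n → ℝ) → (Fin n → ℝ) → ℝ := fun r w =>
        (meetMatrix h r *ᵥ w) ⬝ᵥ S *ᵥ (meetMatrix h r *ᵥ w) with hm
      -- φ expresses proportionality of f(r) and the pulled back S without the unknown factor, which
      -- need not be continuous at q. Off the hyperplane φ is zero, hence also at q, where the
      -- pullback degenerates to S(P, P) (e·w)².
      set φ : (Fin n → ℝ) → ℝ := fun r => (v ⬝ᵥ E.coeff r *ᵥ v) * m r v' -
        (v' ⬝ᵥ E.coeff r *ᵥ v') * m r v with hφ
      have hmc : ∀ w, Continuous fun r => m r w := by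
        intro w
        have h1 : Continuous fun r => meetMatrix h r *ᵥ w := by
          refine continuous_pi fun s => ?_
          have h2 : Continuous (affineForm h) := (contDiff_affineForm (k := 0) h).continuous
          have h3 : Continuous fun r : Fin n → ℝ => (Fin.cons 1 r : Fin (n + 1) → ℝ) s :=
            (contDiff_pi.1 (contDiff_cons_one (k := 0)) s).continuous
          simp only [Matrix.mulVec, dotProduct, meetMatrix, Matrix.of_apply]
          fun_prop
        exact Continuous.dotProduct h1 (Continuous.matrix_mulVec continuous_const h1)
      have hfc : ∀ w, ContinuousAt (fun r => w ⬝ᵥ E.coeff r *ᵥ w) q := by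
        intro w
        simp only [dotProduct_mulVec_eq_sum]
        refine tendsto_finsetSum _ fun i _ => tendsto_finsetSum _ fun j _ => ?_
        exact ((((E.smooth_coeff i j).continuousOn).continuousAt
          (E.isOpen_domain.mem_nhds hq)).mul continuousAt_const).mul continuousAt_const
      have hφc : ContinuousAt φ q :=
        ((hfc v).mul (hmc v').continuousAt).sub ((hfc v').mul (hmc v).continuousAt)
      have hφ0 : φ q = 0 := by
        have hcont : Continuous fun t : ℝ => q + t • e := by fun_prop
        have hlim : Filter.Tendsto (fun t : ℝ => φ (q + t • e)) (𝓝[≠] 0) (𝓝 (φ q)) := by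
          have : ContinuousAt (fun t : ℝ => φ (q + t • e)) 0 :=
            ContinuousAt.comp (g := φ) (f := fun t : ℝ => q + t • e) (by simpa using hφc)
              hcont.continuousAt
          have h2 := this.tendsto.mono_left (nhdsWithin_le_nhds (s := {0}ᶜ))
          simpa using h2
        have hz : (fun t : ℝ => φ (q + t • e)) =ᶠ[𝓝[≠] 0] fun _ => 0 := by
          filter_upwards [(hline q e hq).filter_mono nhdsWithin_le_nhds,
            self_mem_nhdsWithin] with t ht ht0
          obtain ⟨c, hc⟩ := hE _ ht
          have h2 := E.coeff_eq_of_quadric hS ht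
            (by rw [haff, hlq, zero_add]; exact mul_ne_zero ht0 he0) hc
          simp only [hφ, hm]
          rw [h2]
          simp only [Matrix.smul_mulVec, dotProduct_smul, quad_conj, smul_eq_mul]
          ring
        exact tendsto_nhds_unique hlim (tendsto_const_nhds.congr' hz.symm)
      have hmq : ∀ w, m q w = (e ⬝ᵥ w) ^ 2 * (P ⬝ᵥ S *ᵥ P) := by
        intro w
        have h1 : meetMatrix h q *ᵥ w = (-(e ⬝ᵥ w)) • P := by
          rw [meetMatrix_mulVec, hlq, ← he]
          ext s
          refine Fin.cases ?_ (fun i => ?_) s <;> simp [hP]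
        simp only [hm, h1, Matrix.mulVec_smul, dotProduct_smul, smul_dotProduct, smul_eq_mul]
        ring
      have := hφ0
      simp only [hφ, hmq] at this
      linarith
    have hrank : E.coeff q = Matrix.vecMulVec
        (((e ⬝ᵥ E.coeff q *ᵥ e) / (e ⬝ᵥ e) ^ 2) • e) e := by
      refine Matrix.IsSymm.ext_quad (E.symm_coeff q hq) ?_ fun v => ?_
      · ext i j
        simp [Matrix.vecMulVec_apply]
        ring
      · rw [Matrix.vecMulVec_mulVec, op_smul_eq_smul, dotProduct_smul, dotProduct_smul, smul_eq_mul,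
          smul_eq_mul, dotProduct_comm v e]
        have := hid v e
        have h3 : (v ⬝ᵥ E.coeff q *ᵥ v) * (e ⬝ᵥ e) ^ 2 =
            (e ⬝ᵥ E.coeff q *ᵥ e) * (e ⬝ᵥ v) ^ 2 := by
          apply mul_right_cancel₀ hne
          linarith
        field_simp
        linarith
    have : Nontrivial (Fin n) := Fin.nontrivial_iff_two_le.2 hn
    apply E.nondegenerate_coeff q hq
    rw [hrank]
    exact Matrix.det_vecMulVec _ _
  set P : Fin (n + 1) → ℝ := Fin.cons 1 p with hP
  have hPS : ∀ w', h ⬝ᵥ w' = 0 → P ⬝ᵥ S *ᵥ w' = 0 := by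
    intro w' hw'
    set u := dirMatrix p *ᵥ w' with hu
    set U : Fin (n + 1) → ℝ := Fin.cons 0 u with hU
    have hw : w' = w' 0 • P + U := by
      ext s
      refine Fin.cases ?_ (fun i => ?_) s <;> simp [hP, hU, hu, dirMatrix_mulVec]
    have heu : e ⬝ᵥ u = 0 := by
      rw [dotProduct, Fin.sum_univ_succ] at hw'
      rw [hu, dirMatrix_mulVec, dotProduct_sub, dotProduct_smul, smul_eq_mul]
      rw [affineForm_eq] at hl
      simp only [dotProduct, he] at *
      linear_combination hw' - w' 0 * hl
    -- S vanishes on P + tU for all small t, so the coefficient of t, which is 2 S(P, U), vanishes.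
    have hPU : P ⬝ᵥ S *ᵥ U = 0 := by
      have hev : ∀ᶠ t : ℝ in 𝓝 0, t * (2 * (P ⬝ᵥ S *ᵥ U)) + t ^ 2 * (U ⬝ᵥ S *ᵥ U) = 0 := by
        filter_upwards [hline p u hp] with t ht
        have h1 := hSP _ ht (by rw [haff, hl, heu]; ring)
        have h2 : (Fin.cons 1 (p + t • u) : Fin (n + 1) → ℝ) = P + t • U := by
          ext s
          refine Fin.cases ?_ (fun i => ?_) s <;> simp [hP, hU]
        have h3 := dotProduct_mulVec_comm hS U P
        have h4 := hSP p hp hl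
        rw [h2] at h1
        simp only [Matrix.mulVec_add, Matrix.mulVec_smul, dotProduct_add, add_dotProduct,
          dotProduct_smul, smul_dotProduct, smul_eq_mul, h3] at h1
        rw [← hP] at h4
        linear_combination h1 - h4
      obtain ⟨ε, hε, hball⟩ := Metric.eventually_nhds_iff.1 hev
      have h1 := hball (y := ε / 2) (by simp [abs_of_pos hε]; linarith)
      have h2 := hball (y := -(ε / 2)) (by simp [abs_of_pos hε]; linarith)
      have h3 : ε * (P ⬝ᵥ S *ᵥ U) = 0 := by linear_combination (h1 - h2) / 2
      exact (mul_eq_zero.1 h3).resolve_left hε.ne'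
    rw [hw, Matrix.mulVec_add, Matrix.mulVec_smul, dotProduct_add, dotProduct_smul, hPU,
      hSP p hp hl]
    simp
  have := congrFun (hns P hl hPS) 0
  simp [hP] at this

theorem QuasilinearEquation.hasNullComplexThroughHyperplaneQuadric_iff {n : ℕ} (hn : 2 ≤ n)
    (E : QuasilinearEquation n) :
    E.HasNullComplexThroughHyperplaneQuadric ↔ E.HasProjectiveNormalForm := by
  have : NeZero n := ⟨by omega⟩
  rw [E.hasProjectiveNormalForm_iff]
  constructor
  · rintro ⟨K, ⟨d, Φ, -, -, hKΦ, -⟩, hfam, h, S, hh, hS, hns, hsub⟩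
    have hK : ∀ L ∈ K, IsProjLine L := fun L hL => by
      rw [hKΦ] at hL
      exact hL.1
    have hE := fun p hp => E.exists_eq_mul_of_quadric_subset hK hfam hS hns hp (hsub p hp)
    refine ⟨h, S, hS, fun p hp => ?_⟩
    have hl := E.affineForm_ne_zero_of_quadric hn hh hS hns hE hp
    obtain ⟨c, hc⟩ := hE p hp
    have h1 := E.coeff_eq_of_quadric hS hp hl hc
    refine ⟨hl, _, ?_, h1⟩
    intro h0
    rw [h0, zero_smul] at h1
    exact E.coeff_ne_zero hp h1
  · rintro ⟨h, S, hS, hE⟩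
    exact E.hasNullComplex_of_meetMatrix hS hE

/-! ### Quadratic complexes in three-dimensional projective space -/

/-- The matrix of `v ↦ p × v`. -/
def crossMatrix (p : Fin 3 → ℝ) : Matrix (Fin 3) (Fin 3) ℝ :=
  !![0, -p 2, p 1; p 2, 0, -p 0; -p 1, p 0, 0]

theorem crossMatrix_transpose (p : Fin 3 → ℝ) : (crossMatrix p)ᵀ = -crossMatrix p := by
  ext i j
  fin_cases i <;> fin_cases j <;> simp [crossMatrix]

theorem crossMatrix_add (p q : Fin 3 → ℝ) :
    crossMatrix (p + q) = crossMatrix p + crossMatrix q := by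
  ext i j
  fin_cases i <;> fin_cases j <;> simp [crossMatrix] <;> ring

theorem crossMatrix_smul (t : ℝ) (p : Fin 3 → ℝ) : crossMatrix (t • p) = t • crossMatrix p := by
  ext i j
  fin_cases i <;> fin_cases j <;> simp [crossMatrix]

theorem crossMatrix_zero : crossMatrix 0 = 0 := by
  simpa using crossMatrix_smul 0 0

theorem crossMatrix_mulVec_self (p : Fin 3 → ℝ) : crossMatrix p *ᵥ p = 0 := by
  ext i
  fin_cases i <;> simp [crossMatrix, Matrix.mulVec, dotProduct, Fin.sum_univ_three] <;> ring

/-- This is a × (r × v) = (a·v) r - (a·r) v. It makes the slide linear in the Plücker coordinates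
(v, r × v). -/
theorem slideMatrix_eq_crossMatrix (a r : Fin 3 → ℝ) :
    slideMatrix a r = 1 + -crossMatrix a * crossMatrix r := by
  ext i j
  fin_cases i <;> fin_cases j <;>
    simp [slideMatrix, crossMatrix, Matrix.vecMulVec_apply, dotProduct, Fin.sum_univ_three] <;>
    ring

theorem exists_eq_neg_crossMatrix {Z : Matrix (Fin 3) (Fin 3) ℝ} (hZ : Zᵀ = -Z) :
    ∃ a, Z = -crossMatrix a := by
  have h : ∀ i j, Z j i = -Z i j := fun i j => congrFun (congrFun hZ i) j
  refine ⟨![Z 1 2, -Z 0 2, Z 0 1], ?_⟩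
  have h0 := h 0 0
  have h1 := h 1 1
  have h2 := h 2 2
  ext i j
  fin_cases i <;> fin_cases j <;> simp [crossMatrix, h 0 1, h 0 2, h 1 2] <;> linarith

/-- The matrix of the map that sends a direction `v` to the Plücker coordinates `(v, p × v)` of the
line through `p` with direction `v`. -/
def pencilMatrix (p : Fin 3 → ℝ) : Matrix (Fin 3 ⊕ Fin 3) (Fin 3) ℝ :=
  Matrix.fromRows 1 (crossMatrix p)

/-- The matrix of the cone at `p` of the quadratic complex with matrix `M`. -/
def coneMatrix (M : Matrix (Fin 3 ⊕ Fin 3) (Fin 3 ⊕ Fin 3) ℝ) (p : Fin 3 → ℝ) :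
    Matrix (Fin 3) (Fin 3) ℝ :=
  (pencilMatrix p)ᵀ * M * pencilMatrix p

theorem plucker6_homog (p : Fin 3 → ℝ) (v : Fin 3 → ℂ) :
    plucker6 (homog p) (Fin.cons 0 v) = fun s => ∑ j, (pencilMatrix p s j : ℂ) * v j := by
  have h3 : (3 : Fin 4) = Fin.succ 2 := rfl
  have h2 : (2 : Fin 4) = Fin.succ 1 := rfl
  have h1 : (1 : Fin 4) = Fin.succ 0 := rfl
  have hp : ∀ i : Fin 3, homog p i.succ = p i := fun i => by simp [homog]
  have hp0 : homog p 0 = 1 := by simp [homog]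
  ext s
  rcases s with i | i <;> fin_cases i <;>
    simp only [plucker6, plucker, pencilMatrix, crossMatrix, h1, h2, h3, hp, hp0, Fin.cons_succ,
      Fin.cons_zero] <;>
    simp [Fin.sum_univ_three, Matrix.one_apply] <;> ring

theorem lineThrough_mem_quadraticComplex_iff (M : Matrix (Fin 3 ⊕ Fin 3) (Fin 3 ⊕ Fin 3) ℝ)
    (p : Fin 3 → ℝ) {v : Fin 3 → ℂ} (hv : v ≠ 0) :
    lineThrough p v ∈ quadraticComplex M ↔ complexQuad (coneMatrix M p) v = 0 := by
  set g : (Fin 4 × Fin 4 → ℂ) → Fin 3 ⊕ Fin 3 → ℂ := fun x =>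
    Sum.elim ![x (0, 1), x (0, 2), x (0, 3)] ![x (2, 3), x (3, 1), x (1, 2)] with hg
  have hgs : ∀ (c : ℂ) x, g (c • x) = c • g x := by
    intro c x
    ext s
    rcases s with i | i <;> fin_cases i <;> simp [hg]
  have key := forall_mem_span_plucker_iff (n := 3)
    (f := fun x => g x ⬝ᵥ (M.map (fun r : ℝ => (r : ℂ))) *ᵥ g x)
    (fun c x => by
      simp only [hgs, Matrix.mulVec_smul, dotProduct_smul, smul_dotProduct, smul_eq_mul]
      ring) (homog p) (Fin.cons 0 v)
  have h1 : lineThrough p v ∈ quadraticComplex M ↔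
      g (plucker (homog p) (Fin.cons 0 v)) ⬝ᵥ (M.map (fun r : ℝ => (r : ℂ))) *ᵥ
        g (plucker (homog p) (Fin.cons 0 v)) = 0 := by
    rw [← key]
    exact and_iff_right (isProjLine_lineThrough p hv)
  rw [h1, coneMatrix, complexQuad_conj, ← plucker6_homog, dotProduct_mulVec_eq_sum]
  rfl

/-- The complex null directions fix the cone matrix up to a factor, which is nonzero since otherwise
all directions would be null for f(p). -/
theorem QuasilinearEquation.isFamilyOfNullLines_quadraticComplex_iff (E : QuasilinearEquation 3)
    {M : Matrix (Fin 3 ⊕ Fin 3) (Fin 3 ⊕ Fin 3) ℝ} (hM : M.IsSymm) :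
    E.IsFamilyOfNullLines (quadraticComplex M) ↔
      ∀ p ∈ E.domain, ∃ c : ℝ, c ≠ 0 ∧ coneMatrix M p = c • E.coeff p := by
  rw [E.isFamilyOfNullLines_iff]
  constructor
  · intro h p hp
    have h1 : ∀ v : Fin 3 → ℂ, v ≠ 0 →
        (complexQuad (coneMatrix M p) v = 0 ↔ complexQuad (E.coeff p) v = 0) := fun v hv => by
      rw [← h p hp v hv, lineThrough_mem_quadraticComplex_iff M p hv]
    obtain ⟨c, hc⟩ := exists_eq_smul_of_complexQuad (E.symm_coeff p hp)
      (hM.conj (pencilMatrix p)) (E.nondegenerate_coeff p hp) fun v hv => by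
        by_cases hv0 : v = 0
        · simp [hv0, complexQuad]
        · exact (h1 v hv0).2 hv
    refine ⟨c, ?_, hc⟩
    rintro rfl
    refine E.coeff_ne_zero hp (Matrix.IsSymm.ext_quad (E.symm_coeff p hp)
      Matrix.isSymm_zero fun x => ?_)
    by_cases hx : (fun i => (x i : ℂ)) = 0
    · have : x = 0 := funext fun i => by simpa using congrFun hx i
      simp [this]
    · have h2 := (h1 _ hx).1 (by rw [coneMatrix, hc, zero_smul]; simp [complexQuad])
      rw [complexQuad_ofReal] at h2
      rw [Matrix.zero_mulVec, dotProduct_zero]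
      exact_mod_cast h2
  · intro h p hp v hv
    obtain ⟨c, hc, h1⟩ := h p hp
    rw [lineThrough_mem_quadraticComplex_iff M p hv, h1, complexQuad_smul_matrix]
    simp [hc]

/-- The action on Plücker coordinates of the translation by `p`. -/
def translationMatrix (p : Fin 3 → ℝ) : Matrix (Fin 3 ⊕ Fin 3) (Fin 3 ⊕ Fin 3) ℝ :=
  Matrix.fromBlocks 1 0 (crossMatrix p) 1

theorem translationMatrix_mul_neg (p : Fin 3 → ℝ) :
    translationMatrix p * translationMatrix (-p) = 1 := by
  have h : crossMatrix (-p) = -crossMatrix p := by simpa using crossMatrix_smul (-1) p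
  simp [translationMatrix, Matrix.fromBlocks_multiply, h]

theorem translationMatrix_neg_mul (p : Fin 3 → ℝ) :
    translationMatrix (-p) * translationMatrix p = 1 := by
  simpa using translationMatrix_mul_neg (-p)

theorem coneMatrix_translate (M : Matrix (Fin 3 ⊕ Fin 3) (Fin 3 ⊕ Fin 3) ℝ) (p₀ p : Fin 3 → ℝ) :
    coneMatrix M p = coneMatrix ((translationMatrix p₀)ᵀ * M * translationMatrix p₀) (p - p₀) := by
  have h : pencilMatrix p = translationMatrix p₀ * pencilMatrix (p - p₀) := by
    rw [pencilMatrix, pencilMatrix, translationMatrix, Matrix.fromBlocks_mul_fromRows]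
    simp [← crossMatrix_add]
  rw [coneMatrix, coneMatrix, h, Matrix.transpose_mul]
  simp only [Matrix.mul_assoc]

theorem coneMatrix_fromBlocks (B X X' Y : Matrix (Fin 3) (Fin 3) ℝ) (r : Fin 3 → ℝ) :
    coneMatrix (Matrix.fromBlocks B X X' Y) r = B + X * crossMatrix r + (crossMatrix r)ᵀ * X' +
      (crossMatrix r)ᵀ * Y * crossMatrix r := by
  rw [coneMatrix, pencilMatrix, Matrix.mul_assoc, Matrix.fromBlocks_mul_fromRows,
    Matrix.transpose_fromRows, Matrix.fromCols_mul_fromRows]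
  simp only [Matrix.mul_one, Matrix.transpose_one, Matrix.one_mul, Matrix.mul_add,
    Matrix.mul_assoc]
  abel

/-- The matrix of the Plücker form with real entries. -/
def realPluckerMatrix : Matrix (Fin 3 ⊕ Fin 3) (Fin 3 ⊕ Fin 3) ℝ :=
  Matrix.fromBlocks 0 1 1 0

theorem realPluckerMatrix_mul_self : realPluckerMatrix * realPluckerMatrix = 1 := by
  simp [realPluckerMatrix, Matrix.fromBlocks_multiply]

theorem isSymm_realPluckerMatrix : realPluckerMatrix.IsSymm := by
  simp [Matrix.IsSymm, realPluckerMatrix, Matrix.fromBlocks_transpose]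

/-- The Plücker form vanishes on every line: v·(p × v) = 0. So M may be changed by multiples of it
without changing the cones. -/
theorem coneMatrix_realPluckerMatrix (p : Fin 3 → ℝ) : coneMatrix realPluckerMatrix p = 0 := by
  rw [realPluckerMatrix, coneMatrix_fromBlocks, crossMatrix_transpose]
  simp

/-- Translations preserve the Plücker form Ω, so replacing M by TᵀMT conjugates ΩM by T. -/
theorem realPluckerMatrix_mul_transpose (p : Fin 3 → ℝ) :
    realPluckerMatrix * (translationMatrix p)ᵀ = translationMatrix (-p) * realPluckerMatrix := by
  have h : crossMatrix (-p) = -crossMatrix p := by simpa using crossMatrix_smul (-1) p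
  simp [translationMatrix, realPluckerMatrix, Matrix.fromBlocks_transpose,
    Matrix.fromBlocks_multiply, h, crossMatrix_transpose]

theorem pluckerMatrix_inv_mul_map (M : Matrix (Fin 3 ⊕ Fin 3) (Fin 3 ⊕ Fin 3) ℝ) :
    pluckerMatrix⁻¹ * M.map (fun r : ℝ => (r : ℂ)) =
      (realPluckerMatrix * M).map Complex.ofRealHom := by
  have h1 : pluckerMatrix = realPluckerMatrix.map Complex.ofRealHom := by
    ext i j
    rcases i with i | i <;> rcases j with j | j <;>
      simp [pluckerMatrix, realPluckerMatrix, Matrix.one_apply]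
  have h2 : pluckerMatrix⁻¹ = pluckerMatrix := by
    apply Matrix.inv_eq_right_inv
    simp [pluckerMatrix, Matrix.fromBlocks_multiply]
  rw [h2, h1, Matrix.map_mul]
  rfl

/-! ### Segre symbols -/

theorem HasSegreSymbol222.exists_sq_eq_zero {M : Matrix (Fin 3 ⊕ Fin 3) (Fin 3 ⊕ Fin 3) ℝ}
    (h : HasSegreSymbol222 M) : ∃ μ : ℝ,
      (realPluckerMatrix * M - μ • 1) * (realPluckerMatrix * M - μ • 1) = 0 := by
  obtain ⟨μ, G, G', h1, h2, h3⟩ := h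
  rw [pluckerMatrix_inv_mul_map] at h3
  set N := realPluckerMatrix * M with hN
  set J := Matrix.blockDiagonal (fun _ : Fin 3 => !![μ, 1; 0, μ]) with hJ
  -- The single eigenvalue has multiplicity six and the trace is real, so μ is real.
  have htr : ((N.trace : ℝ) : ℂ) = 6 * μ := by
    have h4 : (N.map Complex.ofRealHom).trace = ((N.trace : ℝ) : ℂ) :=
      (AddMonoidHom.map_trace Complex.ofRealHom N).symm
    rw [← h4, h3, Matrix.mul_assoc, Matrix.trace_mul_comm, Matrix.mul_assoc, h2, Matrix.mul_one, hJ,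
      Matrix.trace_blockDiagonal]
    simp [Matrix.trace, Fin.sum_univ_two]
    ring
  have hμ : μ = ((N.trace / 6 : ℝ) : ℂ) := by
    push_cast
    rw [htr]; ring
  refine ⟨N.trace / 6, ?_⟩
  have hJ0 : (J - μ • 1) * (J - μ • 1) = 0 := by
    have h5 : J - μ • 1 = Matrix.blockDiagonal (fun _ : Fin 3 => !![0, 1; 0, 0]) := by
      rw [← Matrix.blockDiagonal_one, ← Matrix.blockDiagonal_smul, hJ, ← Matrix.blockDiagonal_sub]
      congr 1
      ext k i j
      fin_cases i <;> fin_cases j <;> simp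
    rw [h5, ← Matrix.blockDiagonal_mul]
    ext ⟨i, k⟩ ⟨j, l⟩
    simp [Matrix.blockDiagonal_apply]
    fin_cases i <;> fin_cases j <;> simp
  have h6 : (N - (N.trace / 6) • 1).map Complex.ofRealHom = G * (J - μ • 1) * G' := by
    have h7 : (N - (N.trace / 6) • 1).map Complex.ofRealHom =
        N.map Complex.ofRealHom - μ • 1 := by
      rw [hμ]
      ext i j
      simp [Matrix.one_apply, apply_ite Complex.ofReal]
    rw [h7, h3, Matrix.mul_sub, Matrix.sub_mul]
    simp [h1]
  have h8 : ((N - (N.trace / 6) • 1) * (N - (N.trace / 6) • 1)).map Complex.ofRealHom = 0 := by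
    rw [Matrix.map_mul, h6]
    calc G * (J - μ • 1) * G' * (G * (J - μ • 1) * G')
        = G * (J - μ • 1) * (G' * G) * (J - μ • 1) * G' := by simp only [Matrix.mul_assoc]
      _ = G * ((J - μ • 1) * (J - μ • 1)) * G' := by
          rw [h2, Matrix.mul_one]; simp only [Matrix.mul_assoc]
      _ = 0 := by rw [hJ0]; simp
  ext i j
  simpa using congrFun (congrFun h8 i) j

/-- The two blocks of three indices, regrouped. -/
def jordanIndexEquiv : Fin 2 × Fin 3 ≃ Fin 3 ⊕ Fin 3 where
  toFun x := if x.1 = 0 then Sum.inl x.2 else Sum.inr x.2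
  invFun := Sum.elim (fun k => (0, k)) fun k => (1, k)
  left_inv := by
    rintro ⟨i, k⟩
    fin_cases i <;> simp
  right_inv := by
    rintro (k | k) <;> simp

/-- In `blockDiagonal` the index (i, k) is position i in block k; listing positions first turns
three 2×2 Jordan blocks into a 2×2 array of scalar 3×3 blocks. -/
theorem hasSegreSymbol222_of_eq_mul {M : Matrix (Fin 3 ⊕ Fin 3) (Fin 3 ⊕ Fin 3) ℝ} {μ : ℝ}
    {G G' : Matrix (Fin 3 ⊕ Fin 3) (Fin 3 ⊕ Fin 3) ℝ} (h1 : G * G' = 1) (h2 : G' * G = 1)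
    (h3 : realPluckerMatrix * M = G * Matrix.fromBlocks (μ • 1) 1 0 (μ • 1) * G') :
    HasSegreSymbol222 M := by
  refine ⟨μ, (G.map Complex.ofRealHom).submatrix id jordanIndexEquiv,
    (G'.map Complex.ofRealHom).submatrix jordanIndexEquiv id, ?_, ?_, ?_⟩
  · rw [Matrix.submatrix_mul_equiv, ← Matrix.map_mul, h1]
    simp
  · rw [← Matrix.submatrix_mul _ _ _ _ _ Function.bijective_id, ← Matrix.map_mul, h2]
    simp
  · have hJ : Matrix.blockDiagonal (fun _ : Fin 3 => !![(μ : ℂ), 1; 0, (μ : ℂ)]) =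
        ((Matrix.fromBlocks (μ • 1) 1 0 (μ • 1) : Matrix (Fin 3 ⊕ Fin 3) (Fin 3 ⊕ Fin 3) ℝ).map
          Complex.ofRealHom).submatrix jordanIndexEquiv jordanIndexEquiv := by
      ext ⟨i, k⟩ ⟨j, l⟩
      fin_cases i <;> fin_cases j <;>
        simp [Matrix.blockDiagonal_apply, jordanIndexEquiv, Matrix.one_apply,
          apply_ite Complex.ofReal]
    rw [pluckerMatrix_inv_mul_map, h3, hJ, Matrix.submatrix_mul_equiv, Matrix.submatrix_mul_equiv,
      Matrix.map_mul, Matrix.map_mul]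
    simp

/-- The block matrix is (1 | Z)ᵀ B (1 | Z), and (1 | Z) sends (v, r × v) to v - a × (r × v), the
slide of v. -/
theorem coneMatrix_fromBlocks_of_skew {B Z : Matrix (Fin 3) (Fin 3) ℝ} {a : Fin 3 → ℝ}
    (ha : Z = -crossMatrix a) (r : Fin 3 → ℝ) :
    coneMatrix (Matrix.fromBlocks B (B * Z) (Zᵀ * B) (Zᵀ * B * Z)) r =
      (slideMatrix a r)ᵀ * B * slideMatrix a r := by
  rw [coneMatrix_fromBlocks, slideMatrix_eq_crossMatrix, ← ha, Matrix.transpose_add,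
    Matrix.transpose_mul, Matrix.transpose_one]
  simp only [Matrix.mul_add, Matrix.add_mul, Matrix.one_mul, Matrix.mul_one, Matrix.mul_assoc]
  abel

/-- A quadratic complex of null lines whose pencil has a nilpotent part of square zero makes the
conformal structure projectively normal. -/
theorem QuasilinearEquation.hasProjectiveNormalForm_of_sq_eq_zero (E : QuasilinearEquation 3)
    {M : Matrix (Fin 3 ⊕ Fin 3) (Fin 3 ⊕ Fin 3) ℝ} (hM : M.IsSymm)
    (hE : E.IsFamilyOfNullLines (quadraticComplex M)) {μ : ℝ}
    (h : (realPluckerMatrix * M - μ • 1) * (realPluckerMatrix * M - μ • 1) = 0) :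
    E.HasProjectiveNormalForm := by
  rw [E.isFamilyOfNullLines_quadraticComplex_iff hM] at hE
  obtain ⟨p₀, hp₀⟩ := E.nonempty_domain
  set T := translationMatrix p₀ with hT
  -- Removing μ times the Plücker form and moving p₀ to the origin keep the cones and make ΩM'
  -- nilpotent of square zero.
  set M₁ := M - μ • realPluckerMatrix with hM₁
  have hM₁s : M₁.IsSymm := hM.sub (isSymm_realPluckerMatrix.smul μ)
  set M' := Tᵀ * M₁ * T with hM'
  have hM's : M'.IsSymm := hM₁s.conj T
  have hcone : ∀ p, coneMatrix M p = coneMatrix M' (p - p₀) := by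
    intro p
    rw [hM', ← coneMatrix_translate, hM₁]
    have := coneMatrix_realPluckerMatrix p
    rw [coneMatrix] at this ⊢
    rw [coneMatrix, Matrix.mul_sub, Matrix.sub_mul, Matrix.mul_smul, Matrix.smul_mul, this]
    simp
  have hPl : realPluckerMatrix * M₁ = realPluckerMatrix * M - μ • 1 := by
    rw [hM₁, Matrix.mul_sub, Matrix.mul_smul, realPluckerMatrix_mul_self]
  have hsq : (realPluckerMatrix * M') * (realPluckerMatrix * M') = 0 := by
    have h1 : realPluckerMatrix * M' = translationMatrix (-p₀) * (realPluckerMatrix * M₁) * T := by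
      rw [hM', ← Matrix.mul_assoc, ← Matrix.mul_assoc, hT, realPluckerMatrix_mul_transpose]
      simp only [Matrix.mul_assoc]
    rw [h1]
    calc translationMatrix (-p₀) * (realPluckerMatrix * M₁) * T *
          (translationMatrix (-p₀) * (realPluckerMatrix * M₁) * T)
        = translationMatrix (-p₀) * (realPluckerMatrix * M₁) * (T * translationMatrix (-p₀)) *
          (realPluckerMatrix * M₁) * T := by simp only [Matrix.mul_assoc]
      _ = translationMatrix (-p₀) * ((realPluckerMatrix * M₁) * (realPluckerMatrix * M₁)) * T := by
          rw [hT, translationMatrix_mul_neg, Matrix.mul_one]; simp only [Matrix.mul_assoc]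
      _ = 0 := by rw [hPl, h]; simp
  set B := M'.toBlocks₁₁ with hB
  set X := M'.toBlocks₁₂ with hX
  set Y := M'.toBlocks₂₂ with hY
  have hblocks : M' = Matrix.fromBlocks B X Xᵀ Y := by
    have h1 : M'.toBlocks₂₁ = Xᵀ := by
      ext i j
      exact (hM's.apply (Sum.inr i) (Sum.inl j)).symm
    rw [← h1, hB, hX, hY, Matrix.fromBlocks_toBlocks]
  have hBs : Bᵀ = B := by
    ext i j
    exact hM's.apply (Sum.inl i) (Sum.inl j)
  obtain ⟨c₀, hc₀, h0⟩ := hE p₀ hp₀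
  have hB0 : B = c₀ • E.coeff p₀ := by
    rw [← h0, hcone, sub_self, hblocks, coneMatrix_fromBlocks, crossMatrix_zero]
    simp
  have hBu : IsUnit B.det := by
    rw [hB0, Matrix.det_smul]
    exact (mul_ne_zero (pow_ne_zero _ hc₀) (E.nondegenerate_coeff p₀ hp₀)).isUnit
  -- The lower blocks of (ΩM')² = 0 read B Xᵀ + X B = 0 and B Y + X² = 0. With X = BZ and B
  -- invertible, they say that Z is skew and Y = -ZBZ = ZᵀBZ.
  rw [hblocks, realPluckerMatrix, Matrix.fromBlocks_multiply, Matrix.fromBlocks_multiply,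
    ← Matrix.fromBlocks_zero, Matrix.fromBlocks_inj] at hsq
  simp only [Matrix.zero_mul, Matrix.one_mul, zero_add, add_zero] at hsq
  obtain ⟨-, -, h21, h22⟩ := hsq
  set Z := B⁻¹ * X with hZ
  have hBZ : B * Z = X := by
    rw [hZ, ← Matrix.mul_assoc, Matrix.mul_nonsing_inv _ hBu, Matrix.one_mul]
  have hXt : Xᵀ = Zᵀ * B := by rw [← hBZ, Matrix.transpose_mul, hBs]
  have hcancel : ∀ W : Matrix (Fin 3) (Fin 3) ℝ, B * W = 0 → W = 0 := by
    intro W hW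
    rw [← Matrix.one_mul W, ← Matrix.nonsing_inv_mul _ hBu, Matrix.mul_assoc, hW, Matrix.mul_zero]
  have hskew : Zᵀ = -Z := by
    have h1 : B * ((Zᵀ + Z) * B) = 0 := by
      rw [hXt, ← hBZ] at h21
      rw [Matrix.add_mul, Matrix.mul_add, ← h21]
      simp only [Matrix.mul_assoc]
    have h2 := hcancel _ h1
    have h3 : Zᵀ + Z = 0 := by
      rw [← Matrix.mul_one (Zᵀ + Z), ← Matrix.mul_nonsing_inv _ hBu, ← Matrix.mul_assoc, h2,
        Matrix.zero_mul]
    exact eq_neg_of_add_eq_zero_left h3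
  have hYZ : Y = Zᵀ * B * Z := by
    have h1 : B * (Y - Zᵀ * B * Z) = 0 := by
      rw [← hBZ] at h22
      rw [hskew, Matrix.mul_sub, ← h22]
      simp only [Matrix.neg_mul, Matrix.mul_neg, Matrix.mul_assoc]
      abel
    exact sub_eq_zero.1 (hcancel _ h1)
  obtain ⟨a, ha⟩ := exists_eq_neg_crossMatrix hskew
  have hslide : ∀ p, coneMatrix M p =
      (slideMatrix a (p - p₀))ᵀ * B * slideMatrix a (p - p₀) := by
    intro p
    rw [hcone, hblocks, hXt, ← hBZ, hYZ, coneMatrix_fromBlocks_of_skew ha]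
  refine ⟨p₀, hp₀, a, fun p hp => ?_⟩
  obtain ⟨c, hc, h1⟩ := hE p hp
  rw [hslide] at h1
  constructor
  -- With 1 + a·r = 0 the slide matrix becomes -r aᵀ, which is singular, contrary to the
  -- non-degeneracy of f(p).
  · intro hl
    have h2 : (slideMatrix a (p - p₀)).det = 0 := by
      rw [slideMatrix, hl, zero_smul, zero_sub, Matrix.det_neg, Matrix.det_vecMulVec, mul_zero]
    have h3 := congrArg Matrix.det h1
    rw [Matrix.det_mul, h2, mul_zero, Matrix.det_smul] at h3
    exact mul_ne_zero (pow_ne_zero _ hc) (E.nondegenerate_coeff p hp) h3.symm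
  · refine ⟨c⁻¹ * c₀, mul_ne_zero (inv_ne_zero hc) hc₀, ?_⟩
    have h2 : E.coeff p = c⁻¹ • (c • E.coeff p) := by
      rw [smul_smul, inv_mul_cancel₀ hc, one_smul]
    rw [h2, ← h1, hB0, mul_smul]
    simp

/-! ### From the normal form to the Segre symbol -/

/-- Skewness of D[r] gives Dᵀv · (r × v) = 0 for all r and v, so each v is an eigenvector of Dᵀ. It
suffices to compare entries for basis vectors r. -/
theorem exists_eq_smul_one_of_crossMatrix {D : Matrix (Fin 3) (Fin 3) ℝ}
    (h : ∀ r, D * crossMatrix r + (D * crossMatrix r)ᵀ = 0) : ∃ μ : ℝ, D = μ • 1 := by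
  have hr : ∀ r i j, (D * crossMatrix r) i j + (D * crossMatrix r) j i = 0 := fun r i j =>
    congrFun (congrFun (h r) i) j
  simp only [Matrix.mul_apply, Fin.sum_univ_three, crossMatrix] at hr
  have a1 := hr ![1, 0, 0] 1 1
  have a2 := hr ![1, 0, 0] 2 2
  have a3 := hr ![1, 0, 0] 1 2
  have a4 := hr ![1, 0, 0] 0 1
  have a5 := hr ![1, 0, 0] 0 2
  have b1 := hr ![0, 1, 0] 0 0
  have b2 := hr ![0, 1, 0] 2 2
  have b3 := hr ![0, 1, 0] 0 2
  have c1 := hr ![0, 0, 1] 0 0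
  have c2 := hr ![0, 0, 1] 1 1
  simp at a1 a2 a3 a4 a5 b1 b2 b3 c1 c2
  refine ⟨D 0 0, ?_⟩
  ext i j
  fin_cases i <;> fin_cases j <;> simp <;> linarith

/-- Any two vectors of ℝ³ are orthogonal to a common r ≠ 0, hence both of the form r × v, so D pairs
them to zero. -/
theorem eq_zero_of_crossMatrix_conj {D : Matrix (Fin 3) (Fin 3) ℝ}
    (h : ∀ r, (crossMatrix r)ᵀ * D * crossMatrix r = 0) : D = 0 := by
  have hr : ∀ r i j, ((crossMatrix r)ᵀ * D * crossMatrix r) i j = 0 := fun r i j =>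
    congrFun (congrFun (h r) i) j
  simp only [Matrix.mul_apply, Fin.sum_univ_three, crossMatrix, Matrix.transpose_apply] at hr
  have a1 := hr ![1, 0, 0] 1 1
  have a2 := hr ![1, 0, 0] 1 2
  have a3 := hr ![1, 0, 0] 2 1
  have a4 := hr ![1, 0, 0] 2 2
  have b1 := hr ![0, 1, 0] 2 2
  have b2 := hr ![0, 1, 0] 0 2
  have b3 := hr ![0, 1, 0] 2 0
  have c1 := hr ![0, 0, 1] 0 1
  have c2 := hr ![0, 0, 1] 1 0
  simp at a1 a2 a3 a4 b1 b2 b3 c1 c2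
  ext i j
  fin_cases i <;> fin_cases j <;> simp <;> linarith

theorem coeffs_eq_zero_of_eventually {V : Type*} [AddCommGroup V] [Module ℝ V] {u v w : V}
    (h : ∀ᶠ t : ℝ in 𝓝[≠] 0, u + t • v + t ^ 2 • w = 0) : u = 0 ∧ v = 0 ∧ w = 0 := by
  rw [eventually_nhdsWithin_iff, Metric.eventually_nhds_iff] at h
  obtain ⟨ε, hε, hball⟩ := h
  have h1 := hball (y := ε / 2) (by simp [abs_of_pos hε]; linarith) (by simp [hε.ne'])
  have h2 := hball (y := -(ε / 2)) (by simp [abs_of_pos hε]; linarith) (by simp [hε.ne'])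
  have h3 := hball (y := ε / 4) (by simp [abs_of_pos hε]; linarith) (by simp [hε.ne'])
  have hv : v = 0 := by
    -- Subtracting the values at ±ε/2 isolates v; those at ε/2 and ε/4 then isolate w.
    have h4 : ε • v = (u + (ε / 2) • v + (ε / 2) ^ 2 • w) -
        (u + (-(ε / 2)) • v + (-(ε / 2)) ^ 2 • w) := by module
    rw [h1, h2, sub_zero] at h4
    exact (smul_eq_zero.1 h4).resolve_left hε.ne'
  have hw : w = 0 := by
    rw [hv] at h1 h3
    have h4 : (3 * ε ^ 2 / 16) • w = (u + (ε / 2) • (0 : V) + (ε / 2) ^ 2 • w) -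
        (u + (ε / 4) • (0 : V) + (ε / 4) ^ 2 • w) := by module
    rw [h1, h3, sub_zero] at h4
    exact (smul_eq_zero.1 h4).resolve_left (by positivity)
  refine ⟨?_, hv, hw⟩
  simpa [hv, hw] using h1

/-- A quadratic complex of null lines of a projectively normal conformal structure has Segre
symbol `[(222)]`. -/
theorem QuasilinearEquation.hasSegreSymbol222_of_hasProjectiveNormalForm
    (E : QuasilinearEquation 3) (hN : E.HasProjectiveNormalForm)
    {M : Matrix (Fin 3 ⊕ Fin 3) (Fin 3 ⊕ Fin 3) ℝ} (hM : M.IsSymm)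
    (hE : E.IsFamilyOfNullLines (quadraticComplex M)) : HasSegreSymbol222 M := by
  rw [E.isFamilyOfNullLines_quadraticComplex_iff hM] at hE
  obtain ⟨p₀, hp₀, a, hN⟩ := hN
  set T := translationMatrix p₀ with hT
  set M' := Tᵀ * M * T with hM'
  have hM's : M'.IsSymm := hM.conj T
  set B := M'.toBlocks₁₁ with hB
  set X := M'.toBlocks₁₂ with hX
  set Y := M'.toBlocks₂₂ with hY
  have hblocks : M' = Matrix.fromBlocks B X Xᵀ Y := by
    have h1 : M'.toBlocks₂₁ = Xᵀ := by
      ext i j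
      exact (hM's.apply (Sum.inr i) (Sum.inl j)).symm
    rw [← h1, hB, hX, hY, Matrix.fromBlocks_toBlocks]
  have hBs : B.IsSymm := by
    ext i j
    exact hM's.apply (Sum.inl i) (Sum.inl j)
  obtain ⟨c₀, hc₀, h0⟩ := hE p₀ hp₀
  have hB0 : B = c₀ • E.coeff p₀ := by
    rw [← h0, coneMatrix_translate M p₀, ← hT, ← hM', sub_self, hblocks, coneMatrix_fromBlocks,
      crossMatrix_zero]
    simp
  have hBdet : B.det ≠ 0 := by
    rw [hB0, Matrix.det_smul]
    exact mul_ne_zero (pow_ne_zero _ hc₀) (E.nondegenerate_coeff p₀ hp₀)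
  have hBu : IsUnit B.det := hBdet.isUnit
  set Z := -crossMatrix a with hZ
  have hskew : Zᵀ = -Z := by rw [hZ, Matrix.transpose_neg, crossMatrix_transpose]
  set D := X - B * Z with hD
  set F := Y - Zᵀ * B * Z with hF
  have hdiff : ∀ r, coneMatrix M' r - (slideMatrix a r)ᵀ * B * slideMatrix a r =
      (D * crossMatrix r + (D * crossMatrix r)ᵀ) + (crossMatrix r)ᵀ * F * crossMatrix r := by
    intro r
    rw [← coneMatrix_fromBlocks_of_skew hZ, hblocks, coneMatrix_fromBlocks, coneMatrix_fromBlocks,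
      Matrix.transpose_mul, hD, hF, Matrix.transpose_sub, Matrix.transpose_mul, hBs.eq]
    simp only [Matrix.mul_sub, Matrix.sub_mul]
    abel
  -- The two cone matrices are proportional; the factor is found by evaluating at the direction r
  -- itself. Since r × r = 0 and the slide fixes r, both forms give B(r, r) there, so the factor is
  -- one.
  have hquad : ∀ r, p₀ + r ∈ E.domain → r ⬝ᵥ B *ᵥ r ≠ 0 →
      coneMatrix M' r - (slideMatrix a r)ᵀ * B * slideMatrix a r = 0 := by
    intro r hr hBr
    obtain ⟨c, -, h1⟩ := hE _ hr
    obtain ⟨-, c', -, h2⟩ := hN _ hr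
    rw [add_sub_cancel_left] at h2
    rw [coneMatrix_translate M p₀, ← hT, ← hM', add_sub_cancel_left] at h1
    obtain ⟨k, hk⟩ : ∃ k : ℝ, coneMatrix M' r = k • ((slideMatrix a r)ᵀ * B * slideMatrix a r) := by
      refine ⟨c * c' / c₀, ?_⟩
      rw [h1, h2, hB0]
      simp only [Matrix.mul_smul, Matrix.smul_mul, smul_smul, div_mul_cancel₀ _ hc₀]
    have hs : slideMatrix a r *ᵥ r = r := by
      rw [slideMatrix_mulVec, ← sub_smul, add_sub_cancel_right, one_smul]
    have h3 : r ⬝ᵥ coneMatrix M' r *ᵥ r = r ⬝ᵥ B *ᵥ r := by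
      have h4 : coneMatrix M' r *ᵥ r = B *ᵥ r + (crossMatrix r)ᵀ *ᵥ (Xᵀ *ᵥ r) := by
        rw [hblocks, coneMatrix_fromBlocks]
        simp only [Matrix.add_mulVec, ← Matrix.mulVec_mulVec, crossMatrix_mulVec_self,
          Matrix.mulVec_zero, add_zero]
      rw [h4, dotProduct_add, Matrix.dotProduct_mulVec r (crossMatrix r)ᵀ, Matrix.vecMul_transpose,
        crossMatrix_mulVec_self, zero_dotProduct, add_zero]
    rw [hk, Matrix.smul_mulVec, dotProduct_smul, quad_conj, hs, smul_eq_mul] at h3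
    have hk1 : k = 1 := mul_right_cancel₀ hBr (by rw [h3, one_mul])
    rw [hk, hk1, one_smul, sub_self]
  -- Replacing r by t r separates the part linear in r, governed by D, from the quadratic part,
  -- governed by F.
  have hcoef : ∀ r, r ⬝ᵥ B *ᵥ r ≠ 0 → D * crossMatrix r + (D * crossMatrix r)ᵀ = 0 ∧
      (crossMatrix r)ᵀ * F * crossMatrix r = 0 := by
    intro r hr
    refine (coeffs_eq_zero_of_eventually (u := (0 : Matrix (Fin 3) (Fin 3) ℝ)) ?_).2
    have hcont : Continuous fun t : ℝ => p₀ + t • r := by fun_prop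
    have hmem : ∀ᶠ t : ℝ in 𝓝 0, p₀ + t • r ∈ E.domain :=
      hcont.continuousAt.eventually (E.isOpen_domain.mem_nhds (by simpa using hp₀))
    filter_upwards [hmem.filter_mono nhdsWithin_le_nhds, self_mem_nhdsWithin] with t ht ht0
    have ht0' : t ≠ 0 := ht0
    have h1 := hquad (t • r) ht (by
      rw [Matrix.mulVec_smul, dotProduct_smul, smul_dotProduct]
      simp [ht0', hr])
    rw [hdiff, crossMatrix_smul] at h1
    refine Eq.trans ?_ h1
    simp only [Matrix.mul_smul, Matrix.transpose_smul, Matrix.smul_mul, smul_smul, smul_add, pow_two,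
      zero_add]
  obtain ⟨r₁, hr₁⟩ : ∃ r, r ⬝ᵥ B *ᵥ r ≠ 0 := by
    by_contra! hcon
    apply hBdet
    rw [Matrix.IsSymm.ext_quad hBs Matrix.isSymm_zero fun x => by rw [hcon]; simp]
    exact Matrix.det_zero
  -- The condition B(r, r) ≠ 0 is open, so both identities hold at r₁ + t r for small t ≠ 0; the top
  -- coefficients in t give them for every r.
  have hall : ∀ r, D * crossMatrix r + (D * crossMatrix r)ᵀ = 0 ∧
      (crossMatrix r)ᵀ * F * crossMatrix r = 0 := by
    intro r
    have hcont : Continuous fun t : ℝ => (r₁ + t • r) ⬝ᵥ B *ᵥ (r₁ + t • r) := by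
      have h1 : Continuous fun t : ℝ => r₁ + t • r := by fun_prop
      exact Continuous.dotProduct h1 (Continuous.matrix_mulVec continuous_const h1)
    have hne : ∀ᶠ t : ℝ in 𝓝[≠] 0, (r₁ + t • r) ⬝ᵥ B *ᵥ (r₁ + t • r) ≠ 0 :=
      (hcont.continuousAt.eventually_ne (by simpa using hr₁)).filter_mono nhdsWithin_le_nhds
    constructor
    · refine (coeffs_eq_zero_of_eventually (u := D * crossMatrix r₁ + (D * crossMatrix r₁)ᵀ)
        (w := 0) ?_).2.1
      filter_upwards [hne] with t ht
      refine Eq.trans ?_ (hcoef _ ht).1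
      rw [crossMatrix_add, crossMatrix_smul]
      simp only [Matrix.mul_add, Matrix.mul_smul, Matrix.transpose_add, Matrix.transpose_smul,
        smul_add, smul_zero]
      abel
    · refine (coeffs_eq_zero_of_eventually (u := (crossMatrix r₁)ᵀ * F * crossMatrix r₁)
        (v := (crossMatrix r)ᵀ * F * crossMatrix r₁ + (crossMatrix r₁)ᵀ * F * crossMatrix r)
        ?_).2.2
      filter_upwards [hne] with t ht
      refine Eq.trans ?_ (hcoef _ ht).2
      rw [crossMatrix_add, crossMatrix_smul]
      simp only [Matrix.mul_add, Matrix.add_mul, Matrix.mul_smul, Matrix.smul_mul,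
        Matrix.transpose_add, Matrix.transpose_smul, smul_add, smul_smul, pow_two]
      abel
  obtain ⟨μ, hμ⟩ := exists_eq_smul_one_of_crossMatrix fun r => (hall r).1
  have hF0 : F = 0 := eq_zero_of_crossMatrix_conj fun r => (hall r).2
  have hXeq : X = B * Z + μ • 1 := by rw [← hμ, hD]; abel
  have hYeq : Y = Zᵀ * B * Z := sub_eq_zero.1 hF0
  have hXt : Xᵀ = Zᵀ * B + μ • 1 := by
    rw [hXeq, Matrix.transpose_add, Matrix.transpose_mul, hBs.eq]
    simp
  -- Now ΩM' - μ is the product of the column (ZᵀB, B) and the row (1 | Z). It sends the columns of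
  -- (1, 0) to those of (ZᵀB, B), which it kills because Z is skew: these are the Jordan chains
  -- forming G.
  set G : Matrix (Fin 3 ⊕ Fin 3) (Fin 3 ⊕ Fin 3) ℝ := Matrix.fromBlocks (Zᵀ * B) 1 B 0 with hG
  set G' : Matrix (Fin 3 ⊕ Fin 3) (Fin 3 ⊕ Fin 3) ℝ := Matrix.fromBlocks 0 B⁻¹ 1 Z with hG'
  have hGG' : G * G' = 1 := by
    rw [hG, hG', Matrix.fromBlocks_multiply, hskew]
    simp [Matrix.mul_assoc, Matrix.mul_nonsing_inv _ hBu]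
  have hG'G : G' * G = 1 := by
    rw [hG, hG', Matrix.fromBlocks_multiply, Matrix.nonsing_inv_mul _ hBu, hskew]
    simp
  have hPM' : realPluckerMatrix * M' = G * Matrix.fromBlocks (μ • 1) 1 0 (μ • 1) * G' := by
    rw [hblocks, hXt, hYeq, hXeq, hG, hG', realPluckerMatrix, Matrix.fromBlocks_multiply,
      Matrix.fromBlocks_multiply, Matrix.fromBlocks_multiply]
    congr 1
    · simp
    · simp [Matrix.mul_assoc, Matrix.add_mul, Matrix.mul_nonsing_inv _ hBu, hskew]
    · simp
    · simp [Matrix.mul_nonsing_inv _ hBu]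
      abel
  have hTi := translationMatrix_mul_neg p₀
  have hTi' := translationMatrix_neg_mul p₀
  rw [← hT] at hTi hTi'
  set T' := translationMatrix (-p₀) with hT'
  have hPM : realPluckerMatrix * M = T * (realPluckerMatrix * M') * T' := by
    have h1 : T * (realPluckerMatrix * Tᵀ) = realPluckerMatrix := by
      rw [hT, realPluckerMatrix_mul_transpose, ← Matrix.mul_assoc, translationMatrix_mul_neg,
        Matrix.one_mul]
    calc realPluckerMatrix * M = T * (realPluckerMatrix * Tᵀ) * M * (T * T') := by
          rw [h1, hTi, Matrix.mul_one]
      _ = _ := by rw [hM']; simp only [Matrix.mul_assoc]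
  refine hasSegreSymbol222_of_eq_mul (μ := μ) (G := T * G) (G' := G' * T') ?_ ?_ ?_
  · calc T * G * (G' * T') = T * (G * G') * T' := by simp only [Matrix.mul_assoc]
      _ = 1 := by rw [hGG', Matrix.mul_one, hTi]
  · calc G' * T' * (T * G) = G' * (T' * T) * G := by simp only [Matrix.mul_assoc]
      _ = 1 := by rw [hTi', Matrix.mul_one, hG'G]
  · rw [hPM, hPM']
    simp only [Matrix.mul_assoc]

/-- The complex of (1 | Z)ᵀ B (1 | Z) has the required cones when p₀ is the origin; it remains to
translate back. -/
theorem QuasilinearEquation.HasProjectiveNormalForm.exists_quadraticComplex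
    {E : QuasilinearEquation 3} (hN : E.HasProjectiveNormalForm) :
    ∃ M : Matrix (Fin 3 ⊕ Fin 3) (Fin 3 ⊕ Fin 3) ℝ, M.IsSymm ∧
      E.IsFamilyOfNullLines (quadraticComplex M) := by
  obtain ⟨p₀, hp₀, a, hN⟩ := hN
  set Z := -crossMatrix a with hZ
  set B := E.coeff p₀
  have hBs : B.IsSymm := E.symm_coeff p₀ hp₀
  set M' := Matrix.fromBlocks B (B * Z) (Zᵀ * B) (Zᵀ * B * Z) with hM'
  have hM's : M'.IsSymm := by
    rw [Matrix.IsSymm, hM', Matrix.fromBlocks_transpose]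
    simp only [Matrix.transpose_mul, Matrix.transpose_transpose, hBs.eq, Matrix.mul_assoc]
  set M := (translationMatrix (-p₀))ᵀ * M' * translationMatrix (-p₀) with hM
  have hMs : M.IsSymm := hM's.conj _
  have hback : (translationMatrix p₀)ᵀ * M * translationMatrix p₀ = M' := by
    calc (translationMatrix p₀)ᵀ * M * translationMatrix p₀
        = (translationMatrix (-p₀) * translationMatrix p₀)ᵀ * M' *
          (translationMatrix (-p₀) * translationMatrix p₀) := by
          rw [hM, Matrix.transpose_mul]; simp only [Matrix.mul_assoc]
      _ = M' := by rw [translationMatrix_neg_mul]; simp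
  refine ⟨M, hMs, (E.isFamilyOfNullLines_quadraticComplex_iff hMs).2 fun p hp => ?_⟩
  obtain ⟨-, c, hc, h1⟩ := hN p hp
  refine ⟨c⁻¹, inv_ne_zero hc, ?_⟩
  rw [coneMatrix_translate M p₀, hback, hM', coneMatrix_fromBlocks_of_skew hZ, h1, smul_smul,
    inv_mul_cancel₀ hc, one_smul]

/-! ### The equivalences -/

theorem theorem4 :
    (∀ (n : ℕ), 2 ≤ n → ∀ E : QuasilinearEquation n,
      List.TFAE [E.Linearizable,
        E.IsLagrangianQuadraticOverLinear,
        E.HasNullComplexThroughHyperplaneQuadric]) ∧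
    (∀ E : QuasilinearEquation 3,
      (E.HasNullComplexThroughHyperplaneQuadric ↔
        ∃ M : Matrix (Fin 3 ⊕ Fin 3) (Fin 3 ⊕ Fin 3) ℝ, M.IsSymm ∧
          E.IsFamilyOfNullLines (quadraticComplex M) ∧ HasSegreSymbol222 M) ∧
      (∀ M : Matrix (Fin 3 ⊕ Fin 3) (Fin 3 ⊕ Fin 3) ℝ, M.IsSymm →
        E.IsFamilyOfNullLines (quadraticComplex M) →
        (E.HasNullComplexThroughHyperplaneQuadric ↔ HasSegreSymbol222 M))) := by
  constructor
  · intro n hn E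
    have : NeZero n := ⟨by omega⟩
    rw [E.linearizable_iff, E.isLagrangianQuadraticOverLinear_iff,
      E.hasNullComplexThroughHyperplaneQuadric_iff hn]
    tfae_have 1 ↔ 2 := Iff.rfl
    tfae_have 2 ↔ 3 := Iff.rfl
    tfae_finish
  · intro E
    rw [E.hasNullComplexThroughHyperplaneQuadric_iff (by norm_num)]
    have key : ∀ M : Matrix (Fin 3 ⊕ Fin 3) (Fin 3 ⊕ Fin 3) ℝ, M.IsSymm →
        E.IsFamilyOfNullLines (quadraticComplex M) →
        (E.HasProjectiveNormalForm ↔ HasSegreSymbol222 M) := fun M hM hE =>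
      ⟨fun hN => E.hasSegreSymbol222_of_hasProjectiveNormalForm hN hM hE, fun hS => by
        obtain ⟨μ, hμ⟩ := hS.exists_sq_eq_zero
        exact E.hasProjectiveNormalForm_of_sq_eq_zero hM hE hμ⟩
    refine ⟨⟨fun hN => ?_, ?_⟩, key⟩
    · obtain ⟨M, hM, hE⟩ := hN.exists_quadraticComplex
      exact ⟨M, hM, hE, (key M hM hE).1 hN⟩
    · rintro ⟨M, hM, hE, hS⟩
      exact (key M hM hE).2 hS
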